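/- Let $\mathcal A=\{a_i: i\ge 1\}$ be a countably infinite alphabet of distinct letters, and let $X_1,X_2,\dots$ be independent random variables with values in $\mathcal A$ and common distribution $p_i=\mathbb P(X_k=a_i)$, $i\ge1$ (some $p_i$ may be $0$). Assume that the distribution is nonuniform, i.e. that the nonzero $p_i$ are not all equal. Write $p(a_i)=p_i$, $0\ln 0=0$, $H=-\sum_{i\ge1}p_i\ln p_i$ and $\sigma^2=\operatorname{Var}(\ln p(X_1))$. For $n\ge1$ let $Y_i=\#\{k\le n: X_k=a_i\}$, $\hat p_i=Y_i/n$, $\hat H_n=-\sum_{i\ge1}\hat p_i\ln\hat p_i$, let $\hat m=\sum_{i\ge1}\mathbf 1_{\{Y_i>0\}}$ be the number of distinct letters observed, and let $$\hat H_{MM}=\hat H_n+\frac{\hat m-1}{2n}$$ be the Miller–Madow estimator. Let $0<\delta<\tfrac12$ and assume that $\mathbb E|\ln p(X_1)|^{2+\delta}<\infty$ and that there are an integer-valued function $K(n)$ and a constant $C$ such that, for all $n\ge1$, $$K(n)\le n^{\frac12-\delta},\qquad n^{\frac12+\delta}\ln n\sum_{i\ge K(n)}p_i\le C,\qquad -n^{\frac12+\delta}\sum_{i\ge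 K(n)}p_i\ln p_i\le C,$$ the sums being over the integers $i\ge1$ with $i\ge K(n)$. Then there is a constant $C'$, not depending on $n$, such that for all $n\ge1$ $$\sup_{x\in\mathbb R}\left|\mathbb P\left(\frac{\sqrt n\,(\hat H_{MM}-H)}{\sigma}<x\right)-\Phi(x)\right|\le C'n^{-\delta/2},$$ where $\Phi$ is the standard normal distribution function. -/

import Mathlib

open MeasureTheory ProbabilityTheory

namespace MillerMadow

noncomputable section

/-- Shannon's entropy `H = -∑ pᵢ ln pᵢ`, natural logarithm, `0 ln 0 = 0`. -/
def entropy (p : ℕ+ → ℝ) : ℝ := -∑' i, p i * Real.log (p i)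

/-- A distribution is nonuniform if its nonzero probabilities are not all equal
(in particular, a point mass and the uniform law on a finite set of letters are excluded). -/
def Nonuniform (p : ℕ+ → ℝ) : Prop := ∃ i j, 0 < p i ∧ 0 < p j ∧ p i ≠ p j

/-- The tail sum `∑_{i ≥ k} f i` over positive integers `i`. -/
def tailSum (f : ℕ+ → ℝ) (k : ℤ) : ℝ := ∑' i : ℕ+, if k ≤ ((i : ℕ) : ℤ) then f i else 0

variable {Ω α : Type*}

open Classical in
/-- The count `Y_i` of the letter `b` among the first `n` observations `X 0, …, X (n - 1)`. -/
def count (X : ℕ → Ω → α) (n : ℕ) (b : α) (ω : Ω) : ℕ :=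
  ∑ k ∈ Finset.range n, if X k ω = b then 1 else 0

/-- The sample proportion of the letter `b` among the first `n` observations. -/
def phat (X : ℕ → Ω → α) (n : ℕ) (b : α) (ω : Ω) : ℝ := (count X n b ω : ℝ) / n

/-- The number of distinct letters observed, `∑ᵢ 1{Yᵢ > 0}`, the alphabet being enumerated
by `a`; only finitely many terms are nonzero. -/
def mhat (a : ℕ+ ≃ α) (X : ℕ → Ω → α) (n : ℕ) (ω : Ω) : ℕ :=
  ∑' i : ℕ+, if 0 < count X n (a i) ω then 1 else 0

/-- The plug-in estimator of the entropy: the entropy of the empirical distribution. -/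
def plugIn (a : ℕ+ ≃ α) (X : ℕ → Ω → α) (n : ℕ) (ω : Ω) : ℝ :=
  entropy fun i => phat X n (a i) ω

/-- The Miller–Madow estimator `Ĥ_n + (m̂ - 1) / (2 n)`. -/
def estimator (a : ℕ+ ≃ α) (X : ℕ → Ω → α) (n : ℕ) (ω : Ω) : ℝ :=
  plugIn a X n ω + ((mhat a X n ω : ℝ) - 1) / (2 * n)

/-- The random variable `ln p(X_{k+1})`, where `p(aᵢ) = pᵢ`. -/
def logp (a : ℕ+ ≃ α) (p : ℕ+ → ℝ) (X : ℕ → Ω → α) (k : ℕ) (ω : Ω) : ℝ :=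
  Real.log (p (a.symm (X k ω)))

/-- The standard normal distribution function. -/
def Phi (x : ℝ) : ℝ := cdf (gaussianReal 0 1) x

end

end MillerMadow

namespace MillerMadow

open scoped NNReal ENNReal

/-! Write `D` for the Kullback–Leibler divergence of the empirical law from `p`. Then `Ĥ_n - H` is
the sample mean of the i.i.d. centred variables `-ln p(X_k) - H`, minus `D`. Hence `√n (Ĥ_MM - H) /
σ = S + R`, where `S` is a standardized i.i.d. sum and `R = (√n / σ) ((m̂ - 1) / (2n) - D)`
(`hasSum_divTerm`, `estimator_sub_entropy_eq`).

`S` is within `O(n^(-δ/2))` of the normal law by a Berry–Esseen bound under a moment of order `2 +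
δ` (`exists_abs_real_sum_lt_sub_Phi_le`). Its proof compares characteristic functions and smooths
with a Gaussian of standard deviation `n^(-δ/2)`.

`R` is negligible in absolute value, so no cancellation between `D` and the Miller–Madow correction
is needed. In expectation each letter adds at most `1/n` to `D` (a chi-square bound) and at most `1`
to `m̂`; this is used for `i < K(n)`. From `K(n)` on, the bounds `-p_i ln p_i + p_i` and `n p_i` are
summed by the tail hypotheses. Altogether `E(D + m̂/n + 1/n) = O(n^(-1/2-δ))`
(`lintegral_remainder_le`), and Markov's inequality at level `n^(-δ/2)` leaves an exceptional
probability `O(n^(-δ/2))`. Since `Φ` is 1-Lipschitz, adding `R` costs only these two quantities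
(`abs_real_add_lt_sub_Phi_le`). -/

/-! ### Taylor estimates for characteristic functions -/

lemma norm_exp_mul_I_sub_taylor_le {δ : ℝ} (hδ : 0 ≤ δ) (hδ1 : δ ≤ 1) (x : ℝ) :
    ‖Complex.exp (x * Complex.I) - (1 + x * Complex.I - x ^ 2 / 2)‖ ≤ 4 * |x| ^ (2 + δ) := by
  -- For small `x` the cubic Taylor remainder is below the power `2 + δ`; for large `x` every term
  -- is at most a multiple of `x²`.
  rcases le_total |x| 1 with hx | hx
  · have hnorm : ‖(x * Complex.I : ℂ)‖ = |x| := by simp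
    have h := Complex.exp_bound (x := x * Complex.I) (by rw [hnorm]; exact hx) (n := 3) (by norm_num)
    have e : ∑ m ∈ Finset.range 3, (x * Complex.I : ℂ) ^ m / (m.factorial : ℂ)
        = 1 + x * Complex.I - x ^ 2 / 2 := by
      simp only [Finset.sum_range_succ, Finset.sum_range_zero, Nat.factorial, mul_pow, Complex.I_sq]
      push_cast
      ring
    rw [e, hnorm] at h
    refine h.trans ?_
    have h3 : |x| ^ 3 ≤ |x| ^ (2 + δ) := by
      rcases eq_or_lt_of_le (abs_nonneg x) with h0 | h0
      · rw [← h0, Real.zero_rpow (by linarith)]; norm_num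
      · rw [← Real.rpow_natCast]
        exact Real.rpow_le_rpow_of_exponent_ge h0 hx (by push_cast; linarith)
    have h4 : 0 ≤ |x| ^ 3 := by positivity
    norm_num [Nat.factorial]
    linarith
  · have h2 : |x| ^ 2 ≤ |x| ^ (2 + δ) := by
      rw [← Real.rpow_natCast]
      exact Real.rpow_le_rpow_of_exponent_le hx (by push_cast; linarith)
    have h1 : ‖Complex.exp (x * Complex.I) - (1 + x * Complex.I - x ^ 2 / 2)‖
        ≤ 1 + (1 + |x| + |x| ^ 2 / 2) := by
      refine (norm_sub_le _ _).trans (add_le_add (Complex.norm_exp_ofReal_mul_I x).le ?_)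
      refine (norm_sub_le _ _).trans (add_le_add ((norm_add_le _ _).trans ?_) ?_)
      · simp
      · simp
    nlinarith

/-- Remainder of the second order expansion of a characteristic function, in terms of the absolute
moment of order `2 + δ`. -/
lemma norm_charFun_sub_taylor_le {Ω : Type*} [MeasurableSpace Ω] {P : Measure Ω}
    [IsProbabilityMeasure P] {X : Ω → ℝ} {δ : ℝ} (hδ : 0 ≤ δ) (hδ1 : δ ≤ 1)
    (hX : AEMeasurable X P) (h0 : P[X] = 0) (h1 : P[X ^ 2] = 1) (hL : MemLp X 2 P)
    (hint : Integrable (fun ω => |X ω| ^ (2 + δ)) P) (s : ℝ) :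
    ‖charFun (P.map X) s - (1 - s ^ 2 / 2)‖
      ≤ 4 * (∫ ω, |X ω| ^ (2 + δ) ∂P) * |s| ^ (2 + δ) := by
  have hX1 : Integrable X P := hL.integrable (by norm_num)
  have hX2 : Integrable (fun ω => X ω ^ 2) P := hL.integrable_sq
  have hXc : Integrable (fun ω => (X ω : ℂ)) P := hX1.ofReal
  have hX2c : Integrable (fun ω => ((X ω ^ 2 : ℝ) : ℂ)) P := hX2.ofReal
  have e1 : ∫ ω, (1 + (s * X ω : ℝ) * Complex.I - ((s * X ω : ℝ) : ℂ) ^ 2 / 2) ∂P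
      = (1 - s ^ 2 / 2 : ℂ) := by
    have : ∀ ω, (1 + (s * X ω : ℝ) * Complex.I - ((s * X ω : ℝ) : ℂ) ^ 2 / 2)
        = 1 + (s * Complex.I) * (X ω : ℂ) - (s ^ 2 / 2) * ((X ω ^ 2 : ℝ) : ℂ) := by
      intro ω; push_cast; ring
    simp_rw [this]
    have hadd : Integrable (fun ω => 1 + (s * Complex.I) * (X ω : ℂ)) P :=
      (integrable_const _).add (hXc.const_mul _)
    rw [integral_sub hadd (hX2c.const_mul _), integral_add (integrable_const _)
      (hXc.const_mul _), integral_const_mul, integral_const_mul,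
      integral_complex_ofReal, integral_complex_ofReal]
    have h1' : ∫ ω, X ω ^ 2 ∂P = 1 := h1
    rw [h0, h1']
    simp
  have hexp : Integrable (fun ω => Complex.exp ((s * X ω : ℝ) * Complex.I)) P := by
    refine Integrable.of_bound (C := 1) ?_ (Filter.Eventually.of_forall fun ω => ?_)
    · exact (Complex.measurable_exp.comp_aemeasurable
        ((Complex.measurable_ofReal.comp_aemeasurable (hX.const_mul s)).mul_const _)).aestronglyMeasurable
    · exact (Complex.norm_exp_ofReal_mul_I _).le
  have hpoly : Integrable
      (fun ω => (1 + (s * X ω : ℝ) * Complex.I - ((s * X ω : ℝ) : ℂ) ^ 2 / 2)) P := by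
    have : (fun ω => (1 + (s * X ω : ℝ) * Complex.I - ((s * X ω : ℝ) : ℂ) ^ 2 / 2))
        = fun ω => 1 + (s * Complex.I) * (X ω : ℂ) - (s ^ 2 / 2) * ((X ω ^ 2 : ℝ) : ℂ) := by
      funext ω; push_cast; ring
    rw [this]
    exact ((integrable_const _).add (hXc.const_mul _)).sub (hX2c.const_mul _)
  rw [charFun_apply_real, integral_map hX (by fun_prop), ← e1]
  have e2 : ∫ ω, Complex.exp (s * X ω * Complex.I) ∂P
      = ∫ ω, Complex.exp ((s * X ω : ℝ) * Complex.I) ∂P := by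
    simp
  rw [e2, ← integral_sub hexp hpoly]
  refine (norm_integral_le_integral_norm _).trans ?_
  rw [mul_assoc, mul_comm (∫ ω, |X ω| ^ (2 + δ) ∂P), ← integral_const_mul, ← integral_const_mul]
  refine integral_mono (hexp.sub hpoly).norm ((hint.const_mul _).const_mul _) fun ω => ?_
  refine (norm_exp_mul_I_sub_taylor_le hδ hδ1 _).trans ?_
  rw [abs_mul, Real.mul_rpow (abs_nonneg _) (abs_nonneg _)]

/-- Telescoping; the surviving factor `r ^ n` is what later preserves Gaussian decay. -/
lemma norm_pow_sub_pow_le_mul {a b : ℂ} {r : ℝ} (ha : ‖a‖ ≤ r) (hb : ‖b‖ ≤ r) (n : ℕ) :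
    ‖a ^ (n + 1) - b ^ (n + 1)‖ ≤ (n + 1) * ‖a - b‖ * r ^ n := by
  have hr : 0 ≤ r := (norm_nonneg _).trans ha
  induction n with
  | zero => simp
  | succ n ih =>
    have e : a ^ (n + 1 + 1) - b ^ (n + 1 + 1)
        = a * (a ^ (n + 1) - b ^ (n + 1)) + (a - b) * b ^ (n + 1) := by ring
    rw [e]
    calc _ ≤ ‖a‖ * ‖a ^ (n + 1) - b ^ (n + 1)‖ + ‖a - b‖ * ‖b‖ ^ (n + 1) := by
          refine (norm_add_le _ _).trans_eq ?_
          rw [norm_mul, norm_mul, norm_pow]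
      _ ≤ r * ((n + 1) * ‖a - b‖ * r ^ n) + ‖a - b‖ * r ^ (n + 1) := by gcongr
      _ = _ := by push_cast; ring

lemma norm_exp_neg_sq_sub_le {δ : ℝ} (hδ1 : δ ≤ 1) (hδ : 0 ≤ δ) {s : ℝ} (hs : |s| ≤ 1) :
    ‖((Real.exp (-s ^ 2 / 2) : ℝ) : ℂ) - (1 - s ^ 2 / 2)‖ ≤ |s| ^ (2 + δ) := by
  have hs2 : s ^ 2 ≤ 1 := by rw [← sq_abs]; nlinarith [abs_nonneg s]
  have e : ((Real.exp (-s ^ 2 / 2) : ℝ) : ℂ) - (1 - s ^ 2 / 2)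
      = ((Real.exp (-s ^ 2 / 2) - 1 - (-s ^ 2 / 2) : ℝ) : ℂ) := by push_cast; ring
  rw [e, Complex.norm_real]
  have habs : ‖-s ^ 2 / 2‖ = |s| ^ 2 / 2 := by
    rw [Real.norm_eq_abs, abs_div, abs_neg, abs_pow]; norm_num
  refine (Real.norm_exp_sub_one_sub_id_le (by rw [habs, sq_abs]; linarith)).trans ?_
  rw [habs]
  have h3 : |s| ^ 3 ≤ |s| ^ (2 + δ) := by
    rcases eq_or_lt_of_le (abs_nonneg s) with h0 | h0
    · rw [← h0, Real.zero_rpow (by linarith)]; norm_num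
    · rw [← Real.rpow_natCast]
      exact Real.rpow_le_rpow_of_exponent_ge h0 hs (by push_cast; linarith)
  have h4 : |s| ^ 4 ≤ |s| ^ 3 := pow_le_pow_of_le_one (abs_nonneg _) hs (by norm_num)
  nlinarith [abs_nonneg s, pow_nonneg (abs_nonneg s) 4]

/-- If `φ` agrees with `1 - s² / 2` up to `A |s| ^ (2 + δ)`, then near the origin it is dominated by
a Gaussian. -/
lemma norm_le_exp_of_taylor {δ A c s : ℝ} {z : ℂ} (hδ : 0 < δ) (hA : 0 ≤ A)
    (h : ‖z - (1 - s ^ 2 / 2)‖ ≤ A * |s| ^ (2 + δ)) (hc : c ≤ 1)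
    (hAc : A * c ^ δ ≤ 1 / 4) (hs : |s| ≤ c) : ‖z‖ ≤ Real.exp (-s ^ 2 / 4) := by
  have hs1 : |s| ≤ 1 := hs.trans hc
  have hs2 : s ^ 2 ≤ 1 := by rw [← sq_abs]; nlinarith [abs_nonneg s]
  have h1 : |s| ^ (2 + δ) ≤ s ^ 2 * c ^ δ := by
    rw [Real.rpow_add' (abs_nonneg s) (by linarith), Real.rpow_two, sq_abs]
    gcongr
  have h2 : ‖(1 - s ^ 2 / 2 : ℂ)‖ = 1 - s ^ 2 / 2 := by
    rw [show (1 - s ^ 2 / 2 : ℂ) = ((1 - s ^ 2 / 2 : ℝ) : ℂ) by push_cast; ring, Complex.norm_real,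
      Real.norm_of_nonneg (by linarith)]
  have h3 : ‖z‖ ≤ 1 - s ^ 2 / 2 + A * |s| ^ (2 + δ) := by
    calc ‖z‖ = ‖(1 - s ^ 2 / 2 : ℂ) + (z - (1 - s ^ 2 / 2))‖ := by congr 1; ring
      _ ≤ _ := (norm_add_le _ _).trans (by rw [h2]; gcongr)
  -- The remainder uses up at most half of `s² / 2`, leaving `1 - s² / 4`.
  have h4 : A * |s| ^ (2 + δ) ≤ s ^ 2 * (1 / 4) := by
    calc _ ≤ A * (s ^ 2 * c ^ δ) := by gcongr
      _ = s ^ 2 * (A * c ^ δ) := by ring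
      _ ≤ _ := by gcongr
  have h5 := Real.add_one_le_exp (-s ^ 2 / 4)
  linarith

/-- Closeness of the `n`-th power of a characteristic function, suitably rescaled, to the Gaussian
characteristic function. -/
lemma norm_pow_sub_exp_le {δ A c t : ℝ} {φ : ℝ → ℂ} (hδ : 0 < δ) (hδ1 : δ ≤ 1) (hA : 0 ≤ A)
    (h : ∀ s, ‖φ s - (1 - s ^ 2 / 2)‖ ≤ A * |s| ^ (2 + δ)) (hc : c ≤ 1)
    (hAc : A * c ^ δ ≤ 1 / 4) {n : ℕ} (hn : 2 ≤ n) (ht : |t| ≤ c * √n) :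
    ‖φ ((√n)⁻¹ * t) ^ n - ((Real.exp (-t ^ 2 / 2) : ℝ) : ℂ)‖
      ≤ (A + 1) * (n : ℝ) ^ (-δ / 2) * |t| ^ (2 + δ) * Real.exp (-t ^ 2 / 8) := by
  have hn0 : (0 : ℝ) < n := by positivity
  have hsn : 0 < √(n : ℝ) := Real.sqrt_pos.2 hn0
  set s : ℝ := (√n)⁻¹ * t with hsdef
  have hs : |s| ≤ c := by
    rw [hsdef, abs_mul, abs_of_pos (inv_pos.2 hsn), inv_mul_le_iff₀ hsn, mul_comm]; exact ht
  have hs1 : |s| ≤ 1 := hs.trans hc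
  have hns : (n : ℝ) * s ^ 2 = t ^ 2 := by
    rw [hsdef, mul_pow, inv_pow, Real.sq_sqrt hn0.le]; field_simp
  have hexp : ((Real.exp (-t ^ 2 / 2) : ℝ) : ℂ) = ((Real.exp (-s ^ 2 / 2) : ℝ) : ℂ) ^ n := by
    rw [← Complex.ofReal_pow, ← Real.exp_nat_mul, ← hns]; congr 3; ring
  obtain ⟨m, rfl⟩ : ∃ m, n = m + 1 := ⟨n - 1, by omega⟩
  rw [hexp]
  have ha := norm_le_exp_of_taylor hδ hA (h s) hc hAc hs
  have hb : ‖((Real.exp (-s ^ 2 / 2) : ℝ) : ℂ)‖ ≤ Real.exp (-s ^ 2 / 4) := by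
    rw [Complex.norm_real, Real.norm_of_nonneg (Real.exp_pos _).le]
    exact Real.exp_le_exp.2 (by nlinarith [sq_nonneg s])
  refine (norm_pow_sub_pow_le_mul ha hb m).trans ?_
  have hd : ‖φ s - ((Real.exp (-s ^ 2 / 2) : ℝ) : ℂ)‖ ≤ (A + 1) * |s| ^ (2 + δ) := by
    calc _ = ‖(φ s - (1 - s ^ 2 / 2))
          - (((Real.exp (-s ^ 2 / 2) : ℝ) : ℂ) - (1 - s ^ 2 / 2))‖ := by congr 1; ring
      _ ≤ A * |s| ^ (2 + δ) + |s| ^ (2 + δ) :=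
          (norm_sub_le _ _).trans (add_le_add (h s) (norm_exp_neg_sq_sub_le hδ1 hδ.le hs1))
      _ = _ := by ring
  -- Telescoping lost one factor; `n = m + 1 ≥ 2` gives `m ≥ n / 2`, so the exponent is at worst
  -- halved.
  have he : Real.exp (-s ^ 2 / 4) ^ m ≤ Real.exp (-t ^ 2 / 8) := by
    rw [← Real.exp_nat_mul, Real.exp_le_exp, ← hns]
    have : (1 : ℝ) ≤ m := by exact_mod_cast (by omega : 1 ≤ m)
    push_cast
    nlinarith [sq_nonneg s]
  have hpow : ((m + 1 : ℕ) : ℝ) * |s| ^ (2 + δ) = ((m + 1 : ℕ) : ℝ) ^ (-δ / 2) * |t| ^ (2 + δ) := by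
    rw [hsdef, abs_mul, abs_of_pos (inv_pos.2 hsn), Real.mul_rpow (inv_pos.2 hsn).le (abs_nonneg t),
      ← mul_assoc]
    congr 1
    rw [Real.inv_rpow hsn.le, Real.sqrt_eq_rpow, ← Real.rpow_mul hn0.le, ← Real.rpow_neg hn0.le]
    nth_rw 1 [← Real.rpow_one ((m + 1 : ℕ) : ℝ)]
    rw [← Real.rpow_add hn0]
    congr 1; ring
  calc ((m : ℝ) + 1) * ‖φ s - ((Real.exp (-s ^ 2 / 2) : ℝ) : ℂ)‖ * Real.exp (-s ^ 2 / 4) ^ m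
      ≤ (m + 1) * ((A + 1) * |s| ^ (2 + δ)) * Real.exp (-t ^ 2 / 8) := by gcongr
    _ = (A + 1) * (((m + 1 : ℕ) : ℝ) * |s| ^ (2 + δ)) * Real.exp (-t ^ 2 / 8) := by
        push_cast; ring
    _ = _ := by rw [hpow]; ring

/-! ### Gaussian smoothing and Fourier inversion -/

/-- Fourier inversion for the centered Gaussian density. -/
lemma gaussianPDFReal_eq_integral {v : ℝ≥0} (hv : v ≠ 0) (x : ℝ) :
    (gaussianPDFReal 0 v x : ℂ) = (1 / (2 * Real.pi) : ℝ) *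
      ∫ t : ℝ, Complex.exp (Complex.I * x * t) * Complex.exp (-((v / 2 : ℝ) : ℂ) * t ^ 2) := by
  have hv0 : (0 : ℝ) < v := by positivity
  rw [fourierIntegral_gaussian (by rw [Complex.ofReal_re]; positivity) (x : ℂ)]
  have e1 : ((Real.pi : ℂ) / ((v / 2 : ℝ) : ℂ)) ^ (1 / 2 : ℂ)
      = ((√(2 * Real.pi / v) : ℝ) : ℂ) := by
    rw [Real.sqrt_eq_rpow, Complex.ofReal_cpow (by positivity)]
    congr 1
    · push_cast; field_simp
    · push_cast; rfl
  have e2 : Complex.exp (-(x : ℂ) ^ 2 / (4 * ((v / 2 : ℝ) : ℂ)))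
      = ((Real.exp (-x ^ 2 / (2 * v)) : ℝ) : ℂ) := by
    push_cast
    congr 1
    field_simp
    ring
  rw [e1, e2, gaussianPDFReal_def, ← Complex.ofReal_mul, ← Complex.ofReal_mul, ← mul_assoc]
  simp only [sub_zero]
  congr 2
  have h : √(2 * Real.pi / v) = (2 * Real.pi) * (√(2 * Real.pi * v))⁻¹ := by
    rw [Real.sqrt_eq_iff_eq_sq (by positivity) (by positivity), mul_pow, inv_pow,
      Real.sq_sqrt (by positivity)]
    field_simp
  rw [h]
  field_simp

lemma integrable_cexp_neg_mul_sq {v : ℝ≥0} (hv : v ≠ 0) :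
    Integrable fun t : ℝ => Complex.exp (-((v / 2 : ℝ) : ℂ) * t ^ 2) := by
  have hv0 : (0 : ℝ) < v := by positivity
  exact_mod_cast _root_.integrable_cexp_neg_mul_sq (b := ((v / 2 : ℝ) : ℂ))
    (by rw [Complex.ofReal_re]; positivity)

lemma norm_cexp_neg_mul_sq (v t : ℝ) :
    ‖Complex.exp (-((v / 2 : ℝ) : ℂ) * t ^ 2)‖ = Real.exp (-(v / 2) * t ^ 2) := by
  rw [Complex.norm_exp]
  congr 1
  rw [show (-((v / 2 : ℝ) : ℂ) * t ^ 2) = ((-(v / 2) * t ^ 2 : ℝ) : ℂ) by push_cast; ring,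
    Complex.ofReal_re]

/-- The Fourier transform of the indicator function of `[a, b]`. -/
noncomputable def intervalFourier (a b t : ℝ) : ℂ :=
  ∫ u in a..b, Complex.exp (-(Complex.I * u * t))

lemma norm_cexp_neg_I_mul (u t : ℝ) : ‖Complex.exp (-(Complex.I * u * t))‖ = 1 := by
  rw [show -(Complex.I * u * t) = ((-(u * t) : ℝ) : ℂ) * Complex.I by push_cast; ring,
    Complex.norm_exp_ofReal_mul_I]

lemma norm_intervalFourier_le (a b t : ℝ) : ‖intervalFourier a b t‖ ≤ |b - a| := by
  have := intervalIntegral.norm_integral_le_of_norm_le_const (a := a) (b := b) (C := 1)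
    (f := fun u : ℝ => Complex.exp (-(Complex.I * u * t)))
    (fun u _ => (norm_cexp_neg_I_mul u t).le)
  simpa [intervalFourier] using this

/-- Decay `2 / |t|` uniform in the interval: it pays for the factor `|t|` in the later hypotheses on
`g`, and survives letting an endpoint go to infinity. -/
lemma abs_mul_norm_intervalFourier_le (a b t : ℝ) : |t| * ‖intervalFourier a b t‖ ≤ 2 := by
  rcases eq_or_ne t 0 with rfl | ht
  · simp
  have e : intervalFourier a b t = (Complex.exp (-(Complex.I * b * t))
      - Complex.exp (-(Complex.I * a * t))) / (-(Complex.I * t)) := by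
    have h := integral_exp_mul_complex (a := a) (b := b) (c := -(Complex.I * t))
      (by simp [ht])
    rw [intervalFourier, show (fun u : ℝ => Complex.exp (-(Complex.I * u * t)))
      = fun u : ℝ => Complex.exp (-(Complex.I * t) * u) by funext u; congr 1; ring, h]
    congr 3 <;> ring
  have h2 : ‖Complex.exp (-(Complex.I * b * t)) - Complex.exp (-(Complex.I * a * t))‖ ≤ 2 := by
    refine (norm_sub_le _ _).trans ?_
    rw [norm_cexp_neg_I_mul, norm_cexp_neg_I_mul]; norm_num
  have ht' : 0 < |t| := abs_pos.2 ht
  rw [e, norm_div]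
  have : ‖(-(Complex.I * t) : ℂ)‖ = |t| := by simp
  rw [this, mul_div_cancel₀ _ ht'.ne']
  exact h2

lemma continuous_intervalFourier (a b : ℝ) : Continuous (intervalFourier a b) := by
  refine intervalIntegral.continuous_parametric_intervalIntegral_of_continuous'
    (f := fun t u : ℝ => Complex.exp (-(Complex.I * u * t))) ?_ a b
  fun_prop

/-- The left side is the Gaussian density convolved with the indicator of the interval; insert
Fourier inversion and exchange the integrals. -/
lemma gaussianReal_real_Ico {v : ℝ≥0} (hv : v ≠ 0) {a b : ℝ} (hab : a ≤ b) (y : ℝ) :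
    ((gaussianReal 0 v).real (Set.Ico (a - y) (b - y)) : ℂ) = (1 / (2 * Real.pi) : ℝ) *
      ∫ t : ℝ, Complex.exp (Complex.I * y * t) *
        (Complex.exp (-((v / 2 : ℝ) : ℂ) * t ^ 2) * intervalFourier a b t) := by
  have e1 : (gaussianReal 0 v).real (Set.Ico (a - y) (b - y))
      = ∫ u in a..b, gaussianPDFReal 0 v (y - u) := by
    rw [Measure.real, gaussianReal_apply_eq_integral _ hv, ENNReal.toReal_ofReal
      (integral_nonneg fun x => gaussianPDFReal_nonneg _ _ _), setIntegral_congr_set Ico_ae_eq_Ioc,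
      ← intervalIntegral.integral_of_le (by linarith),
      ← intervalIntegral.integral_comp_sub_right (fun x => gaussianPDFReal 0 v x) y]
    congr 1
    funext u
    simp only [gaussianPDFReal_def, sub_zero]
    congr 3
    ring
  rw [e1, ← intervalIntegral.integral_ofReal]
  simp_rw [gaussianPDFReal_eq_integral hv]
  rw [intervalIntegral.integral_const_mul, intervalIntegral_integral_swap]
  · congr 2
    funext t
    rw [intervalFourier, ← intervalIntegral.integral_const_mul, ← intervalIntegral.integral_const_mul]
    congr 1
    funext u
    simp only [← Complex.exp_add]
    congr 1
    push_cast
    ring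
  · have : IsFiniteMeasure (volume.restrict (Set.uIoc a b)) :=
      ⟨by rw [Measure.restrict_apply_univ, Set.uIoc]; exact measure_Ioc_lt_top⟩
    have hg : Integrable (fun z : ℝ × ℝ => (1 : ℂ) * Complex.exp (-((v / 2 : ℝ) : ℂ) * z.2 ^ 2))
        ((volume.restrict (Set.uIoc a b)).prod volume) :=
      Integrable.mul_prod (integrable_const _) (integrable_cexp_neg_mul_sq hv)
    refine hg.mono (by fun_prop) (Filter.Eventually.of_forall fun z => ?_)
    simp only [Function.uncurry, norm_mul, one_mul]
    rw [show Complex.I * ((y - z.1 : ℝ) : ℂ) * z.2 = (((y - z.1) * z.2 : ℝ) : ℂ) * Complex.I by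
      push_cast; ring, Complex.norm_exp_ofReal_mul_I, one_mul]

lemma integral_gaussianReal_real_Ico {v : ℝ≥0} (hv : v ≠ 0) {a b : ℝ} (hab : a ≤ b)
    (ν : Measure ℝ) [IsProbabilityMeasure ν] :
    ((∫ y, (gaussianReal 0 v).real (Set.Ico (a - y) (b - y)) ∂ν : ℝ) : ℂ)
      = (1 / (2 * Real.pi) : ℝ) * ∫ t : ℝ, charFun ν t *
        (Complex.exp (-((v / 2 : ℝ) : ℂ) * t ^ 2) * intervalFourier a b t) := by
  rw [← integral_complex_ofReal]
  simp_rw [gaussianReal_real_Ico hv hab]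
  rw [integral_const_mul, integral_integral_swap]
  · congr 2
    funext t
    rw [integral_mul_const, charFun_apply_real]
    congr 3
    funext y
    congr 1
    ring
  · have hg : Integrable (fun z : ℝ × ℝ => ((|b - a| : ℝ) : ℂ) *
        Complex.exp (-((v / 2 : ℝ) : ℂ) * z.2 ^ 2)) (ν.prod volume) :=
      Integrable.mul_prod (integrable_const _) (integrable_cexp_neg_mul_sq hv)
    have hc := continuous_intervalFourier a b
    refine hg.mono (by unfold Function.uncurry; fun_prop) (Filter.Eventually.of_forall fun z => ?_)
    simp only [Function.uncurry, norm_mul]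
    rw [show Complex.I * (z.1 : ℂ) * z.2 = ((z.1 * z.2 : ℝ) : ℂ) * Complex.I by
      push_cast; ring, Complex.norm_exp_ofReal_mul_I, one_mul, mul_comm, Complex.norm_real,
      Real.norm_eq_abs, abs_abs]
    gcongr
    exact norm_intervalFourier_le a b z.2

/-- Two laws smoothed by a Gaussian are close on intervals when their characteristic functions are
close. -/
lemma abs_integral_gaussianReal_real_Ico_sub_le {v : ℝ≥0} (hv : v ≠ 0) {a b : ℝ} (hab : a ≤ b)
    (ν ν' : Measure ℝ) [IsProbabilityMeasure ν] [IsProbabilityMeasure ν'] {g : ℝ → ℝ}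
    (hg : Integrable g)
    (h : ∀ t, ‖charFun ν t - charFun ν' t‖ * Real.exp (-(v / 2) * t ^ 2) ≤ |t| * g t) :
    |∫ y, (gaussianReal 0 v).real (Set.Ico (a - y) (b - y)) ∂ν
      - ∫ y, (gaussianReal 0 v).real (Set.Ico (a - y) (b - y)) ∂ν'| ≤ ∫ t, g t := by
  have hint : ∀ (ν : Measure ℝ) [IsProbabilityMeasure ν], Integrable fun t : ℝ => charFun ν t *
      (Complex.exp (-((v / 2 : ℝ) : ℂ) * t ^ 2) * intervalFourier a b t) := by
    intro ν _
    have hc := continuous_intervalFourier a b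
    refine ((integrable_cexp_neg_mul_sq hv).const_mul ((|b - a| : ℝ) : ℂ)).mono ?_
      (Filter.Eventually.of_forall fun t => ?_)
    · exact stronglyMeasurable_charFun.aestronglyMeasurable.mul
        (Continuous.aestronglyMeasurable (by fun_prop))
    · rw [norm_mul, norm_mul, norm_mul, Complex.norm_real, Real.norm_eq_abs, abs_abs]
      calc _ ≤ 1 * (‖Complex.exp (-((v / 2 : ℝ) : ℂ) * t ^ 2)‖ * |b - a|) := by
            gcongr
            · exact norm_charFun_le_one t
            · exact norm_intervalFourier_le a b t
        _ = _ := by ring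
  rw [← Real.norm_eq_abs, ← Complex.norm_real, Complex.ofReal_sub,
    integral_gaussianReal_real_Ico hv hab, integral_gaussianReal_real_Ico hv hab, ← mul_sub,
    ← integral_sub (hint ν) (hint ν'), norm_mul, Complex.norm_real,
    Real.norm_of_nonneg (by positivity)]
  have hpt : ∀ t, t ≠ 0 → ‖charFun ν t * (Complex.exp (-((v / 2 : ℝ) : ℂ) * t ^ 2) *
      intervalFourier a b t) - charFun ν' t * (Complex.exp (-((v / 2 : ℝ) : ℂ) * t ^ 2) *
      intervalFourier a b t)‖ ≤ 2 * g t := by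
    intro t ht
    have ht' : 0 < |t| := abs_pos.2 ht
    rw [← sub_mul, ← mul_assoc, norm_mul, norm_mul, norm_cexp_neg_mul_sq]
    calc _ ≤ |t| * g t * ‖intervalFourier a b t‖ :=
          mul_le_mul_of_nonneg_right (h t) (norm_nonneg _)
      _ = (|t| * ‖intervalFourier a b t‖) * g t := by ring
      _ ≤ 2 * g t := by
        have hgt : 0 ≤ g t := by
          have h0 := (mul_nonneg (norm_nonneg _) (Real.exp_pos _).le).trans (h t)
          exact nonneg_of_mul_nonneg_right h0 ht'
        gcongr
        exact abs_mul_norm_intervalFourier_le a b t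
  have hae : ∀ᵐ t : ℝ, t ≠ 0 := by
    rw [ae_iff]; simp
  have h1 : ‖∫ t : ℝ, (charFun ν t * (Complex.exp (-((v / 2 : ℝ) : ℂ) * t ^ 2) *
      intervalFourier a b t) - charFun ν' t * (Complex.exp (-((v / 2 : ℝ) : ℂ) * t ^ 2) *
      intervalFourier a b t))‖ ≤ ∫ t, 2 * g t :=
    norm_integral_le_of_norm_le (hg.const_mul 2) (hae.mono hpt)
  have hg0 : 0 ≤ ∫ t, g t := by
    have := (norm_nonneg _).trans h1
    rw [integral_const_mul] at this
    linarith
  rw [integral_const_mul] at h1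
  -- This absorbs the `2` from the bound on `intervalFourier`.
  have hpi : 1 / (2 * Real.pi) ≤ 1 / 2 := by
    have := Real.two_le_pi
    exact one_div_le_one_div_of_le (by norm_num) (by linarith)
  calc _ ≤ 1 / 2 * (2 * ∫ t, g t) := by gcongr
    _ = _ := by ring

/-- Both sides are the probability that a sum of independent variables with laws `ν` and `γ` falls
in `[a, b)`. -/
lemma integral_real_Ico_comm (ν γ : Measure ℝ) [IsProbabilityMeasure ν] [IsProbabilityMeasure γ]
    (a b : ℝ) :
    ∫ z, ν.real (Set.Ico (a - z) (b - z)) ∂γ = ∫ y, γ.real (Set.Ico (a - y) (b - y)) ∂ν := by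
  have key : ∀ (ν γ : Measure ℝ) [IsProbabilityMeasure ν] [IsProbabilityMeasure γ],
      ∫ z, ν.real (Set.Ico (a - z) (b - z)) ∂γ
        = (γ.prod ν).real {p | p.1 + p.2 ∈ Set.Ico a b} := by
    intro ν γ _ _
    have hm : MeasurableSet {p : ℝ × ℝ | p.1 + p.2 ∈ Set.Ico a b} :=
      measurableSet_Ico.preimage (by fun_prop)
    have hpre : ∀ z : ℝ, Prod.mk z ⁻¹' {p : ℝ × ℝ | p.1 + p.2 ∈ Set.Ico a b}
        = Set.Ico (a - z) (b - z) := by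
      intro z; ext y
      simp only [Set.mem_preimage, Set.mem_ofPred_eq, Set.mem_Ico]
      constructor <;> rintro ⟨h1, h2⟩ <;> constructor <;> linarith
    have hmeas := measurable_measure_prodMk_left (ν := ν) hm
    rw [Measure.real, Measure.prod_apply hm, ← integral_toReal hmeas.aemeasurable
      (Filter.Eventually.of_forall fun _ => measure_lt_top _ _)]
    simp_rw [hpre]
    rfl
  have hm : MeasurableSet {p : ℝ × ℝ | p.1 + p.2 ∈ Set.Ico a b} :=
    measurableSet_Ico.preimage (by fun_prop)
  rw [key, key, ← Measure.prod_swap, measureReal_def, Measure.map_apply measurable_swap hm,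
    measureReal_def]
  congr 2
  ext p
  simp [add_comm]

/-! ### Removing the smoothing -/

/-- A function with one-sided Lipschitz control, all of whose averages over translates of `γ` are
small, is itself small. -/
lemma abs_le_of_abs_integral_comp_sub_le {D : ℝ → ℝ} (hD : Measurable D) {M₀ : ℝ}
    (hM₀ : ∀ x, |D x| ≤ M₀) {L : ℝ} (hL : 0 ≤ L) (hlip : ∀ x y, x ≤ y → D x - L * (y - x) ≤ D y)
    (γ : Measure ℝ) [IsProbabilityMeasure γ] {r : ℝ}
    (hγ : 3 / 4 ≤ γ.real (Set.Icc (-r) r)) {B : ℝ} (hB : ∀ b, |∫ z, D (b - z) ∂γ| ≤ B) (x : ℝ) :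
    |D x| ≤ 3 * r * L + 2 * B := by
  have hB0 : 0 ≤ B := (abs_nonneg _).trans (hB 0)
  have hbdd : BddAbove (Set.range fun x => |D x|) := ⟨M₀, by rintro _ ⟨x, rfl⟩; exact hM₀ x⟩
  set M := ⨆ x, |D x| with hM
  have hle : ∀ x, |D x| ≤ M := fun x => le_ciSup hbdd x
  have hM0 : 0 ≤ M := (abs_nonneg _).trans (hle 0)
  have hA : MeasurableSet (Set.Icc (-r) r) := measurableSet_Icc
  have hint : ∀ b, Integrable (fun z => D (b - z)) γ := fun b =>
    Integrable.of_bound (hD.comp (by fun_prop)).aestronglyMeasurable M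
      (Filter.Eventually.of_forall fun z => by rw [Real.norm_eq_abs]; exact hle _)
  -- `s` will be a translate of `±D`, shifted by `r` so that one-sided control keeps it above `b -
  -- 2rL` on `[-r, r]`. The rest has mass at most `1/4` and `s ≥ -M` there, so averaging gives
  -- `(3/4)(b - 2rL) - M/4 ≤ B`.
  have key : ∀ s : ℝ → ℝ, (∀ b, Integrable s γ → |∫ z, s z ∂γ| ≤ B →
      (∀ z, -M ≤ s z) → (∀ z ∈ Set.Icc (-r) r, b - 2 * r * L ≤ s z) →
        b ≤ 2 * r * L + 4 / 3 * B + M / 3) := by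
    intro s b hs hsB hsM hsA
    rcases le_total (b - 2 * r * L + M) 0 with h0 | h0
    · linarith
    have h1 : ∫ z, (-M + (Set.Icc (-r) r).indicator (fun _ => b - 2 * r * L + M) z) ∂γ
        ≤ ∫ z, s z ∂γ := by
      refine integral_mono ((integrable_const _).add ((integrable_const _).indicator hA)) hs
        fun z => ?_
      by_cases hz : z ∈ Set.Icc (-r) r
      · simpa [Set.indicator_of_mem hz] using hsA z hz
      · simpa [Set.indicator_of_notMem hz] using hsM z
    rw [integral_add (integrable_const _) ((integrable_const _).indicator hA), integral_const,
      integral_indicator_const _ hA] at h1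
    simp only [probReal_univ, smul_eq_mul, one_mul] at h1
    have h2 := (abs_le.1 hsB).2
    nlinarith
  have hall : ∀ x, |D x| ≤ 2 * r * L + 4 / 3 * B + M / 3 := by
    intro x
    refine abs_le'.2 ⟨key (fun z => D (x + r - z)) (D x) (hint _) (hB _)
      (fun z => (abs_le.1 (hle _)).1) fun z hz => ?_, key (fun z => -D (x - r - z)) (-D x)
      (hint _).neg (by rw [integral_neg, abs_neg]; exact hB _)
      (fun z => by linarith [(abs_le.1 (hle (x - r - z))).2]) fun z hz => ?_⟩
    · have := hlip x (x + r - z) (by linarith [hz.2])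
      nlinarith [hz.1, hz.2]
    · have := hlip (x - r - z) x (by linarith [hz.1])
      nlinarith [hz.1, hz.2]
  -- `M` is finite, so the term `M / 3` can be absorbed on the left.
  have hsup : M ≤ 2 * r * L + 4 / 3 * B + M / 3 := ciSup_le hall
  linarith [hle x]

/-! ### The normal distribution function and the smoothing inequality -/

lemma Phi_eq_Iic (x : ℝ) : Phi x = (gaussianReal 0 1).real (Set.Iic x) := cdf_eq_real _ _

lemma Phi_eq_Iio (x : ℝ) : Phi x = (gaussianReal 0 1).real (Set.Iio x) := by
  have := nullSingletonClass_gaussianReal (μ := 0) (v := 1) one_ne_zero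
  rw [Phi_eq_Iic]
  exact measureReal_congr Iio_ae_eq_Iic.symm

lemma Phi_mono : Monotone Phi := monotone_cdf _

lemma Phi_nonneg (x : ℝ) : 0 ≤ Phi x := cdf_nonneg _ _

lemma Phi_le_one (x : ℝ) : Phi x ≤ 1 := cdf_le_one _ _

lemma Phi_sub_le {x y : ℝ} (hxy : x ≤ y) : Phi y - Phi x ≤ y - x := by
  have e : Phi y - Phi x = (gaussianReal 0 1).real (Set.Ioc x y) := by
    rw [Phi_eq_Iic, Phi_eq_Iic, ← measureReal_sdiff (Set.Iic_subset_Iic.2 hxy) measurableSet_Iic]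
    congr 1
    ext z; simp [and_comm]
  rw [e, Measure.real, gaussianReal_apply_eq_integral _ one_ne_zero, ENNReal.toReal_ofReal
      (integral_nonneg fun x => gaussianPDFReal_nonneg _ _ _)]
  refine (le_abs_self _).trans ?_
  rw [← Real.norm_eq_abs]
  refine (norm_setIntegral_le_of_norm_le_const (C := 1) measure_Ioc_lt_top fun z _ => ?_).trans ?_
  · rw [Real.norm_of_nonneg (gaussianPDFReal_nonneg _ _ _), gaussianPDFReal_def]
    have h1 : (√(2 * Real.pi * (1 : ℝ≥0)))⁻¹ ≤ 1 := by
      apply inv_le_one_of_one_le₀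
      rw [Real.one_le_sqrt]
      have := Real.two_le_pi
      push_cast; linarith
    have h2 : Real.exp (-(z - 0) ^ 2 / (2 * (1 : ℝ≥0))) ≤ 1 := by
      rw [Real.exp_le_one_iff]
      push_cast
      nlinarith [sq_nonneg (z - 0)]
    exact mul_le_one₀ h1 (Real.exp_pos _).le h2
  · simp [hxy]

/-- Chebyshev's inequality at two standard deviations. -/
lemma gaussianReal_real_Icc_ge {ε : ℝ} (hε : 0 < ε) :
    3 / 4 ≤ (gaussianReal 0 (ε ^ 2).toNNReal).real (Set.Icc (-(2 * ε)) (2 * ε)) := by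
  set γ := gaussianReal 0 (ε ^ 2).toNNReal
  have h := meas_ge_le_variance_div_sq (μ := γ) (X := id)
    (by simpa using memLp_id_gaussianReal (μ := 0) (v := (ε ^ 2).toNNReal) 2)
    (c := 2 * ε) (by positivity)
  have hv : Var[id; γ] = ε ^ 2 := by
    rw [variance_id_gaussianReal, Real.coe_toNNReal _ (by positivity)]
  have hm : ∫ x, id x ∂γ = 0 := integral_id_gaussianReal
  rw [hv, hm, show ε ^ 2 / (2 * ε) ^ 2 = 1 / 4 by field_simp; norm_num] at h
  have h1 : γ.real {ω | 2 * ε ≤ |id ω - 0|} ≤ 1 / 4 :=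
    ENNReal.toReal_le_of_le_ofReal (by norm_num) h
  have h2 : γ.real (Set.Icc (-(2 * ε)) (2 * ε))ᶜ ≤ 1 / 4 := by
    refine (measureReal_mono fun z hz => ?_).trans h1
    simp only [Set.mem_compl_iff, Set.mem_Icc, ← abs_le, not_le] at hz
    simpa using hz.le
  rw [probReal_compl_eq_one_sub measurableSet_Icc] at h2
  linarith

/-- A smoothing inequality of Esseen type, with a Gaussian kernel. -/
lemma abs_real_Iio_sub_Phi_le (ν : Measure ℝ) [IsProbabilityMeasure ν] {ε : ℝ} (hε : 0 < ε)
    {g : ℝ → ℝ} (hg : Integrable g)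
    (h : ∀ t, ‖charFun ν t - ((Real.exp (-t ^ 2 / 2) : ℝ) : ℂ)‖ * Real.exp (-(ε ^ 2 / 2) * t ^ 2)
      ≤ |t| * g t) (x : ℝ) :
    |ν.real (Set.Iio x) - Phi x| ≤ 6 * ε + 2 * ∫ t, g t := by
  set v : ℝ≥0 := (ε ^ 2).toNNReal with hvdef
  have hvε : (v : ℝ) = ε ^ 2 := Real.coe_toNNReal _ (by positivity)
  have hv : v ≠ 0 := by
    intro h0; rw [h0, NNReal.coe_zero] at hvε; exact (pow_pos hε 2).ne hvε
  set D : ℝ → ℝ := fun x => ν.real (Set.Iio x) - Phi x with hD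
  have hνmono : Monotone fun x => ν.real (Set.Iio x) := fun x y hxy =>
    measureReal_mono (Set.Iio_subset_Iio hxy)
  have hDm : Measurable D := hνmono.measurable.sub Phi_mono.measurable
  have hD1 : ∀ x, |D x| ≤ 1 := fun x => by
    rw [abs_le]
    have h1 : ν.real (Set.Iio x) ≤ 1 := measureReal_le_one
    have h2 : 0 ≤ ν.real (Set.Iio x) := measureReal_nonneg
    constructor <;> simp only [hD] <;> linarith [Phi_nonneg x, Phi_le_one x]
  have hDint : ∀ b, Integrable (fun z => D (b - z)) (gaussianReal 0 v) := fun b =>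
    Integrable.of_bound (hDm.comp (by fun_prop)).aestronglyMeasurable 1
      (Filter.Eventually.of_forall fun z => by rw [Real.norm_eq_abs]; exact hD1 _)
  have hIco : ∀ (ν : Measure ℝ) [IsProbabilityMeasure ν] (a b : ℝ), a ≤ b →
      ν.real (Set.Ico a b) = ν.real (Set.Iio b) - ν.real (Set.Iio a) := by
    intro ν _ a b hab
    rw [← measureReal_sdiff (Set.Iio_subset_Iio hab) measurableSet_Iio]
    congr 1
    ext z; simp
  have hIint : ∀ (ν : Measure ℝ) [IsProbabilityMeasure ν] (a b : ℝ), a ≤ b →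
      Integrable (fun z => ν.real (Set.Ico (a - z) (b - z))) (gaussianReal 0 v) := by
    intro ν _ a b hab
    have hm : Monotone fun x => ν.real (Set.Iio x) := fun x y hxy =>
      measureReal_mono (Set.Iio_subset_Iio hxy)
    refine Integrable.of_bound (C := 1) ?_ (Filter.Eventually.of_forall fun z => ?_)
    · have : (fun z => ν.real (Set.Ico (a - z) (b - z)))
          = fun z => ν.real (Set.Iio (b - z)) - ν.real (Set.Iio (a - z)) :=
        funext fun z => hIco ν _ _ (by linarith)
      rw [this]
      exact ((hm.measurable.comp (measurable_const.sub measurable_id)).sub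
        (hm.measurable.comp (measurable_const.sub measurable_id))).aestronglyMeasurable
    · rw [Real.norm_of_nonneg measureReal_nonneg]; exact measureReal_le_one
  have hchar : ∀ t, charFun (gaussianReal 0 1) t = ((Real.exp (-t ^ 2 / 2) : ℝ) : ℂ) := by
    intro t
    rw [charFun_gaussianReal]
    push_cast
    congr 1
    ring
  have hB : ∀ b, |∫ z, D (b - z) ∂(gaussianReal 0 v)| ≤ ∫ t, g t := by
    intro b
    -- The Fourier bound concerns bounded intervals but does not depend on `a`, so `a` can be sent
    -- to `-∞`, where `D` vanishes.
    have h1 : ∀ a, a ≤ b →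
        |∫ z, D (b - z) ∂(gaussianReal 0 v) - ∫ z, D (a - z) ∂(gaussianReal 0 v)| ≤ ∫ t, g t := by
      intro a hab
      have h2 := abs_integral_gaussianReal_real_Ico_sub_le hv hab ν (gaussianReal 0 1) hg
        (by simp only [hchar, hvε]; exact h)
      rw [← integral_real_Ico_comm ν (gaussianReal 0 v),
        ← integral_real_Ico_comm (gaussianReal 0 1) (gaussianReal 0 v),
        ← integral_sub (hIint _ _ _ hab) (hIint _ _ _ hab)] at h2
      rw [← integral_sub (hDint b) (hDint a)]
      convert h2 using 3
      funext z
      rw [hIco _ _ _ (by linarith), hIco _ _ _ (by linarith), ← Phi_eq_Iio, ← Phi_eq_Iio]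
      simp only [hD]
      ring
    have hDlim : Filter.Tendsto D Filter.atBot (nhds 0) := by
      have e : D = fun x => ν.real (Set.Iio x) - Phi x := rfl
      have h3 : Filter.Tendsto (fun x => ν.real (Set.Iio x)) Filter.atBot (nhds 0) :=
        squeeze_zero (fun _ => measureReal_nonneg)
          (fun x => by rw [cdf_eq_real]; exact measureReal_mono Set.Iio_subset_Iic_self)
          (tendsto_cdf_atBot ν)
      have h4 : Filter.Tendsto Phi Filter.atBot (nhds 0) := tendsto_cdf_atBot _
      simpa [e] using h3.sub h4
    have hlim : Filter.Tendsto (fun a => ∫ z, D (a - z) ∂(gaussianReal 0 v)) Filter.atBot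
        (nhds 0) := by
      have := tendsto_integral_filter_of_dominated_convergence (μ := gaussianReal 0 v)
        (F := fun a z => D (a - z)) (f := fun _ => 0) (l := Filter.atBot) (fun _ => 1)
        (Filter.Eventually.of_forall fun a => (hDint a).aestronglyMeasurable)
        (Filter.Eventually.of_forall fun a => Filter.Eventually.of_forall fun z => by
          rw [Real.norm_eq_abs]; exact hD1 _) (integrable_const _)
        (Filter.Eventually.of_forall fun z => hDlim.comp
          (Filter.tendsto_atBot_add_const_right _ (-z) Filter.tendsto_id))
      simpa using this
    have hlim2 := (tendsto_const_nhds (x := ∫ z, D (b - z) ∂(gaussianReal 0 v))).sub hlim |>.abs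
    rw [sub_zero] at hlim2
    refine le_of_tendsto hlim2 ?_
    filter_upwards [Filter.eventually_le_atBot b] with a ha using h1 a ha
  -- One-sided control needs only that `Φ` is 1-Lipschitz and that the distribution function of `ν`
  -- increases. With `r = 2ε` the term `3rL` is `6ε`.
  have := abs_le_of_abs_integral_comp_sub_le hDm hD1 (L := 1) zero_le_one
    (fun x y hxy => by
      have h1 := Phi_sub_le hxy
      have h2 := hνmono hxy
      simp only [hD] at *
      linarith) (gaussianReal 0 v) (gaussianReal_real_Icc_ge hε) hB x
  calc _ ≤ _ := this
    _ = _ := by ring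

/-! ### Berry–Esseen bound and perturbation -/

lemma integrable_one_add_sq_mul_exp :
    Integrable fun t : ℝ => (1 + t ^ 2) * Real.exp (-t ^ 2 / 8) := by
  have h1 := integrable_exp_neg_mul_sq (b := 1 / 8) (by norm_num)
  have h2 := integrable_rpow_mul_exp_neg_mul_sq (b := 1 / 8) (by norm_num) (s := 2) (by norm_num)
  refine (h1.add h2).congr (Filter.Eventually.of_forall fun t => ?_)
  simp only [Pi.add_apply, Real.rpow_two]
  rw [show -(1 / 8) * t ^ 2 = -t ^ 2 / 8 by ring]
  ring

/-- A **Berry–Esseen** bound for standardized i.i.d. variables with finite absolute moment of order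
`2 + δ`. -/
theorem exists_abs_real_sum_lt_sub_Phi_le {Ω : Type*} [MeasurableSpace Ω] {P : Measure Ω}
    [IsProbabilityMeasure P] {Y : ℕ → Ω → ℝ} {δ : ℝ} (hδ : 0 < δ) (hδ1 : δ ≤ 1 / 2)
    (hindep : iIndepFun Y P) (hident : ∀ i, IdentDistrib (Y i) (Y 0) P P)
    (h0 : P[Y 0] = 0) (h1 : P[Y 0 ^ 2] = 1) (hL : MemLp (Y 0) 2 P)
    (hint : Integrable (fun ω => |Y 0 ω| ^ (2 + δ)) P) :
    ∃ C : ℝ, 0 ≤ C ∧ ∀ n : ℕ, 1 ≤ n → ∀ x : ℝ,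
      |P.real {ω | (√n)⁻¹ * ∑ k ∈ Finset.range n, Y k ω < x} - Phi x|
        ≤ C * (n : ℝ) ^ (-δ / 2) := by
  have hYm : ∀ i, AEMeasurable (Y i) P := fun i => (hident i).aemeasurable_fst
  set A : ℝ := 4 * ∫ ω, |Y 0 ω| ^ (2 + δ) ∂P with hA
  have hA0 : 0 ≤ A := mul_nonneg (by norm_num) (integral_nonneg fun ω => by positivity)
  -- Chosen so that `A c ^ δ ≤ 1/4`; `A + 1` avoids a zero denominator.
  set c : ℝ := min 1 ((1 / (4 * (A + 1))) ^ (1 / δ)) with hcdef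
  have hc1 : c ≤ 1 := min_le_left _ _
  have hc0 : 0 < c := lt_min one_pos (by positivity)
  have hAc : A * c ^ δ ≤ 1 / 4 := by
    have h2 : c ^ δ ≤ 1 / (4 * (A + 1)) := by
      calc c ^ δ ≤ ((1 / (4 * (A + 1))) ^ (1 / δ)) ^ δ :=
            Real.rpow_le_rpow hc0.le (min_le_right _ _) hδ.le
        _ = _ := by
          rw [← Real.rpow_mul (by positivity), one_div_mul_cancel hδ.ne', Real.rpow_one]
    calc A * c ^ δ ≤ A * (1 / (4 * (A + 1))) := by gcongr
      _ ≤ 1 / 4 := by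
        rw [mul_one_div, div_le_div_iff₀ (by positivity) (by norm_num)]; linarith
  set G : ℝ := ∫ t : ℝ, (1 + t ^ 2) * Real.exp (-t ^ 2 / 8) with hG
  have hG0 : 0 ≤ G := integral_nonneg fun t => by positivity
  -- `1` covers `n = 1`, where the power estimate does not apply; `6` comes from smoothing and the
  -- rest bounds `2 ∫ g`.
  refine ⟨1 + 6 + 2 * ((A + 1) * G + 2 / c * √(2 * Real.pi)), by positivity, fun n hn x => ?_⟩
  have hnpos : (0 : ℝ) < n := by exact_mod_cast hn
  have hε : 0 < (n : ℝ) ^ (-δ / 2) := by positivity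
  have hSm : AEMeasurable (fun ω => (√n)⁻¹ * ∑ k ∈ Finset.range n, Y k ω) P :=
    .const_mul (Finset.aemeasurable_fun_sum _ fun _ _ => hYm _) _
  rcases eq_or_lt_of_le hn with rfl | hn2
  · have h2 : 0 ≤ 6 + 2 * ((A + 1) * G + 2 / c * √(2 * Real.pi)) := by positivity
    rw [Nat.cast_one, Real.one_rpow, mul_one, abs_le]
    have h3 : P.real {ω | (√1)⁻¹ * ∑ k ∈ Finset.range 1, Y k ω < x} ≤ 1 := measureReal_le_one
    have h4 : 0 ≤ P.real {ω | (√1)⁻¹ * ∑ k ∈ Finset.range 1, Y k ω < x} := measureReal_nonneg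
    constructor <;> linarith [Phi_nonneg x, Phi_le_one x]
  set ε : ℝ := (n : ℝ) ^ (-δ / 2) with hεdef
  set ν := P.map (fun ω => (√n)⁻¹ * ∑ k ∈ Finset.range n, Y k ω) with hν
  have : IsProbabilityMeasure ν := Measure.isProbabilityMeasure_map hSm
  have hsn : 0 < √(n : ℝ) := Real.sqrt_pos.2 hnpos
  have hνx : P.real {ω | (√n)⁻¹ * ∑ k ∈ Finset.range n, Y k ω < x} = ν.real (Set.Iio x) := by
    rw [hν, measureReal_def, measureReal_def, Measure.map_apply_of_aemeasurable hSm measurableSet_Iio]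
    rfl
  rw [hνx]
  -- The first summand serves `|t| ≤ c√n`, the second the complement. The Gaussian kernel has no
  -- compact Fourier support, so large `t` must be controlled too.
  set g : ℝ → ℝ := fun t => (A + 1) * ε * ((1 + t ^ 2) * Real.exp (-t ^ 2 / 8))
    + 2 / (c * √n) * Real.exp (-(ε ^ 2 / 2) * t ^ 2) with hgdef
  have hi1 := integrable_one_add_sq_mul_exp.const_mul ((A + 1) * ε)
  have hi2 := (integrable_exp_neg_mul_sq (b := ε ^ 2 / 2) (by positivity)).const_mul (2 / (c * √n))
  have hgint : Integrable g := hi1.add hi2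
  have hgval : ∫ t, g t ≤ ((A + 1) * G + 2 / c * √(2 * Real.pi)) * ε := by
    rw [hgdef, integral_add hi1 hi2, integral_const_mul, integral_const_mul, integral_gaussian,
      ← hG]
    have e1 : √(Real.pi / (ε ^ 2 / 2)) = √(2 * Real.pi) / ε := by
      rw [show Real.pi / (ε ^ 2 / 2) = 2 * Real.pi / ε ^ 2 by field_simp,
        Real.sqrt_div (by positivity), Real.sqrt_sq hε.le]
    -- This is `n^(-1/2) ≤ n^(-δ)`, which needs `δ ≤ 1/2`: large frequencies cost `n^(-1/2) / ε`,
    -- hence at most order `ε`.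
    have e2 : 1 / √(n : ℝ) ≤ ε * ε := by
      rw [Real.sqrt_eq_rpow, one_div, ← Real.rpow_neg hnpos.le, hεdef, ← Real.rpow_add hnpos]
      exact Real.rpow_le_rpow_of_exponent_le (by exact_mod_cast hn) (by linarith)
    rw [e1]
    have e3 : 2 / (c * √n) * (√(2 * Real.pi) / ε)
        = (2 / c * √(2 * Real.pi)) * ((1 / √(n : ℝ)) / ε) := by field_simp
    have e4 : (1 / √(n : ℝ)) / ε ≤ ε := by rw [div_le_iff₀ hε]; exact e2
    rw [e3]
    calc _ ≤ (A + 1) * ε * G + 2 / c * √(2 * Real.pi) * ε := by gcongr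
      _ = _ := by ring
  have hφ : ∀ s, ‖charFun (P.map (Y 0)) s - (1 - s ^ 2 / 2)‖ ≤ A * |s| ^ (2 + δ) := fun s =>
    norm_charFun_sub_taylor_le hδ.le (by linarith) (hYm 0) h0 h1 hL hint s
  have hmain := abs_real_Iio_sub_Phi_le ν hε hgint (fun t => ?_) x
  · refine hmain.trans ?_
    have h2 : 0 ≤ ε := hε.le
    nlinarith
  · rw [hν, charFun_inv_sqrt_mul_sum hindep hident]
    have hpos1 : 0 ≤ (A + 1) * ε * ((1 + t ^ 2) * Real.exp (-t ^ 2 / 8)) := by positivity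
    have hpos2 : 0 ≤ 2 / (c * √n) * Real.exp (-(ε ^ 2 / 2) * t ^ 2) := by positivity
    rcases le_total |t| (c * √n) with ht | ht
    · have h2 := norm_pow_sub_exp_le hδ (by linarith) hA0 hφ hc1 hAc hn2 ht
      have h3 : Real.exp (-(ε ^ 2 / 2) * t ^ 2) ≤ 1 := by
        rw [Real.exp_le_one_iff]; nlinarith [mul_nonneg (sq_nonneg ε) (sq_nonneg t)]
      have h4 : |t| ^ (2 + δ) ≤ |t| * (1 + t ^ 2) := by
        rw [show (2 + δ) = 1 + (1 + δ) by ring, Real.rpow_add' (abs_nonneg t) (by linarith),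
          Real.rpow_one]
        gcongr
        rcases le_total |t| 1 with h5 | h5
        · have := Real.rpow_le_one (abs_nonneg t) h5 (by linarith : 0 ≤ 1 + δ)
          nlinarith [sq_nonneg t]
        · have := Real.rpow_le_rpow_of_exponent_le h5 (by linarith : 1 + δ ≤ 2)
          rw [Real.rpow_two, sq_abs] at this
          linarith
      calc _ ≤ ((A + 1) * ε * |t| ^ (2 + δ) * Real.exp (-t ^ 2 / 8)) * 1 := by gcongr
        _ ≤ ((A + 1) * ε * (|t| * (1 + t ^ 2)) * Real.exp (-t ^ 2 / 8)) * 1 := by gcongr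
        _ = |t| * ((A + 1) * ε * ((1 + t ^ 2) * Real.exp (-t ^ 2 / 8))) := by ring
        _ ≤ _ := by
          simp only [hgdef]
          gcongr
          linarith
    · have hcs : 0 < c * √(n : ℝ) := by positivity
      have h2 : ‖charFun (P.map (Y 0)) ((√n)⁻¹ * t) ^ n - ((Real.exp (-t ^ 2 / 2) : ℝ) : ℂ)‖
          ≤ 2 := by
        have : IsProbabilityMeasure (P.map (Y 0)) := Measure.isProbabilityMeasure_map (hYm 0)
        refine (norm_sub_le _ _).trans ?_
        rw [norm_pow, Complex.norm_real, Real.norm_of_nonneg (Real.exp_pos _).le]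
        have h3 : ‖charFun (P.map (Y 0)) ((√n)⁻¹ * t)‖ ^ n ≤ 1 :=
          pow_le_one₀ (norm_nonneg _) (norm_charFun_le_one _)
        have h4 : Real.exp (-t ^ 2 / 2) ≤ 1 := by
          rw [Real.exp_le_one_iff]; nlinarith [sq_nonneg t]
        linarith
      -- For `|t| ≥ c√n` the trivial bound `2` already carries the required factor `|t|`.
      have h3 : 2 ≤ |t| * (2 / (c * √n)) := by
        rw [mul_div_assoc', le_div_iff₀ hcs]; linarith
      calc _ ≤ |t| * (2 / (c * √n)) * Real.exp (-(ε ^ 2 / 2) * t ^ 2) := by gcongr; exact h2.trans h3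
        _ = |t| * (2 / (c * √n) * Real.exp (-(ε ^ 2 / 2) * t ^ 2)) := by ring
        _ ≤ _ := by
          simp only [hgdef]
          gcongr
          linarith

/-- A perturbation that exceeds `ε` with probability at most `η` changes the distance to the normal
law by at most `ε + η`. -/
lemma abs_real_add_lt_sub_Phi_le {Ω : Type*} [MeasurableSpace Ω] {P : Measure Ω}
    [IsProbabilityMeasure P] {S R : Ω → ℝ} {B ε η : ℝ} (hε : 0 ≤ ε)
    (hS : ∀ x, |P.real {ω | S ω < x} - Phi x| ≤ B) (hR : P.real {ω | ε < |R ω|} ≤ η) (x : ℝ) :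
    |P.real {ω | S ω + R ω < x} - Phi x| ≤ B + ε + η := by
  have h1 : P.real {ω | S ω + R ω < x} ≤ P.real {ω | S ω < x + ε} + P.real {ω | ε < |R ω|} := by
    refine (measureReal_mono (fun ω hω => ?_)).trans (measureReal_union_le _ _)
    rcases lt_or_ge ε |R ω| with h | h
    · exact Or.inr h
    · left
      have := (abs_le.1 h).1
      simp only [Set.mem_ofPred_eq] at hω ⊢
      linarith
  have h2 : P.real {ω | S ω < x - ε} ≤ P.real {ω | S ω + R ω < x} + P.real {ω | ε < |R ω|} := by
    refine (measureReal_mono (fun ω hω => ?_)).trans (measureReal_union_le _ _)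
    rcases lt_or_ge ε |R ω| with h | h
    · exact Or.inr h
    · left
      have := (abs_le.1 h).2
      simp only [Set.mem_ofPred_eq] at hω ⊢
      linarith
  have h3 := abs_le.1 (hS (x + ε))
  have h4 := abs_le.1 (hS (x - ε))
  have h5 := Phi_sub_le (show x ≤ x + ε by linarith)
  have h6 := Phi_sub_le (show x - ε ≤ x by linarith)
  rw [abs_le]
  constructor <;> linarith

/-! ### Termwise divergence bounds -/

/-- The `i`-th term of the generalized Kullback–Leibler divergence of `q` from `p`. -/
noncomputable def divTerm (q p : ℝ) : ℝ := q * Real.log q - q * Real.log p - q + p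

lemma divTerm_nonneg {q p : ℝ} (hq : 0 ≤ q) (hp : 0 < p) : 0 ≤ divTerm q p := by
  rcases hq.eq_or_lt with rfl | hq
  · simpa [divTerm] using hp.le
  have h := Real.log_le_sub_one_of_pos (div_pos hp hq)
  rw [Real.log_div hp.ne' hq.ne'] at h
  have h2 := mul_le_mul_of_nonneg_left h hq.le
  have h3 : q * (p / q - 1) = p - q := by field_simp
  rw [h3] at h2
  unfold divTerm
  linarith

/-- `log x ≤ x - 1` at `x = q / p`. With `q = p̂_i` the mean of the right side is at most `1/n`,
whatever `p_i` is. -/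
lemma divTerm_le_sq_div {q p : ℝ} (hq : 0 ≤ q) (hp : 0 < p) : divTerm q p ≤ (q - p) ^ 2 / p := by
  rcases hq.eq_or_lt with rfl | hq
  · simp [divTerm, sq, hp.ne']
  have h := Real.log_le_sub_one_of_pos (div_pos hq hp)
  rw [Real.log_div hq.ne' hp.ne'] at h
  have h2 := mul_le_mul_of_nonneg_left h hq.le
  have h3 : (q - p) ^ 2 / p = q * (q / p - 1) - q + p := by field_simp; ring
  rw [h3]
  unfold divTerm
  linarith

/-- Discarding `q log q` and `-q` leaves a bound affine in `q`, so its expectation is explicit; this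
serves the rare letters. -/
lemma divTerm_le_of_le_one {q p : ℝ} (hq : 0 ≤ q) (hq1 : q ≤ 1) :
    divTerm q p ≤ -(q * Real.log p) + p := by
  have := mul_nonpos_of_nonneg_of_nonpos hq (Real.log_nonpos hq hq1)
  unfold divTerm
  linarith

/-! ### Law of a random letter -/

lemma prob_nonneg {Ω α : Type*} [MeasurableSpace Ω] {μ : Measure Ω} {a : ℕ+ ≃ α} {p : ℕ+ → ℝ}
    {Z : Ω → α} (hlaw : ∀ i, μ.real {ω | Z ω = a i} = p i) (i : ℕ+) : 0 ≤ p i := by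
  rw [← hlaw i]; exact measureReal_nonneg

lemma prob_le_one {Ω α : Type*} [MeasurableSpace Ω] {μ : Measure Ω} [IsProbabilityMeasure μ]
    {a : ℕ+ ≃ α} {p : ℕ+ → ℝ} {Z : Ω → α} (hlaw : ∀ i, μ.real {ω | Z ω = a i} = p i) (i : ℕ+) :
    p i ≤ 1 := by
  rw [← hlaw i]; exact measureReal_le_one

lemma ae_prob_pos {Ω α : Type*} [MeasurableSpace Ω] {μ : Measure Ω} [IsProbabilityMeasure μ]
    {a : ℕ+ ≃ α} {p : ℕ+ → ℝ} {Z : Ω → α} (hlaw : ∀ i, μ.real {ω | Z ω = a i} = p i) :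
    ∀ᵐ ω ∂μ, 0 < p (a.symm (Z ω)) := by
  have h : ∀ i, ∀ᵐ ω ∂μ, Z ω = a i → 0 < p i := by
    intro i
    rcases (prob_nonneg hlaw i).eq_or_lt with h0 | h0
    · have : μ {ω | Z ω = a i} = 0 := by
        rw [← measureReal_eq_zero_iff, hlaw i, ← h0]
      filter_upwards [measure_eq_zero_iff_ae_notMem.1 this] with ω hω h1
      exact absurd h1 hω
    · exact Filter.Eventually.of_forall fun _ _ => h0
  filter_upwards [ae_all_iff.2 h] with ω hω
  exact hω _ (a.apply_symm_apply _).symm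

section Law

variable {Ω α : Type*} [MeasurableSpace Ω] {μ : Measure Ω}
  [MeasurableSpace α] [MeasurableSingletonClass α] {a : ℕ+ ≃ α} {p : ℕ+ → ℝ}

lemma measurableSet_eq_letter {Z : Ω → α} (hZ : Measurable Z) (b : α) :
    MeasurableSet {ω | Z ω = b} :=
  hZ (measurableSet_singleton b)

/-- The expectation of a function of a random letter. -/
lemma hasSum_prob_mul {Z : Ω → α} (hZ : Measurable Z)
    (hlaw : ∀ i, μ.real {ω | Z ω = a i} = p i) {f : ℕ+ → ℝ}
    (hf : Integrable (fun ω => f (a.symm (Z ω))) μ) :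
    HasSum (fun i => p i * f i) (∫ ω, f (a.symm (Z ω)) ∂μ) := by
  have hdisj : Pairwise (Function.onFun Disjoint fun i => {ω | Z ω = a i}) := by
    intro i j hij
    refine Set.disjoint_left.2 fun ω h1 h2 => hij (a.injective ?_)
    exact (show Z ω = a i from h1).symm.trans h2
  have h := hasSum_integral_iUnion (fun i => measurableSet_eq_letter hZ (a i)) hdisj
    hf.integrableOn
  have huniv : ⋃ i, {ω | Z ω = a i} = Set.univ :=
    Set.eq_univ_of_forall fun ω => Set.mem_iUnion.2 ⟨a.symm (Z ω), by simp⟩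
  rw [huniv, setIntegral_univ] at h
  refine h.congr_fun fun i => ?_
  rw [setIntegral_congr_fun (g := fun _ => f i) (measurableSet_eq_letter hZ (a i))
    (fun ω hω => by
      have : Z ω = a i := hω
      simp [this]), setIntegral_const, hlaw i, smul_eq_mul]

lemma hasSum_prob [IsProbabilityMeasure μ] {Z : Ω → α} (hZ : Measurable Z)
    (hlaw : ∀ i, μ.real {ω | Z ω = a i} = p i) : HasSum p 1 := by
  have := hasSum_prob_mul hZ hlaw (f := fun _ => 1) (integrable_const (1 : ℝ))
  simpa using this

lemma measurable_comp_letter (a : ℕ+ ≃ α) {Z : Ω → α} (hZ : Measurable Z) (f : α → ℝ) :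
    Measurable fun ω => f (Z ω) := by
  have : Countable α := a.symm.injective.countable
  exact (measurable_of_countable f).comp hZ

lemma identDistrib_letter [IsProbabilityMeasure μ] {Z Z' : Ω → α} (hZ : Measurable Z)
    (hZ' : Measurable Z')
    (hlaw : ∀ i, μ.real {ω | Z ω = a i} = p i) (hlaw' : ∀ i, μ.real {ω | Z' ω = a i} = p i) :
    IdentDistrib Z Z' μ μ := by
  have : Countable α := a.symm.injective.countable
  refine ⟨hZ.aemeasurable, hZ'.aemeasurable, Measure.ext_iff_singleton.2 fun b => ?_⟩
  rw [Measure.map_apply hZ (measurableSet_singleton b),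
    Measure.map_apply hZ' (measurableSet_singleton b)]
  have h := (hlaw (a.symm b)).trans (hlaw' (a.symm b)).symm
  rw [a.apply_symm_apply] at h
  exact (measureReal_eq_measureReal_iff).1 h

end Law

/-! ### Counts, empirical proportions and their expectations -/

section Count

variable {Ω α : Type*} (a : ℕ+ ≃ α) (X : ℕ → Ω → α) (n : ℕ)

open Classical in
lemma count_cast (b : α) (ω : Ω) :
    (count X n b ω : ℝ) = ∑ k ∈ Finset.range n, if X k ω = b then (1 : ℝ) else 0 := by
  simp [count]

lemma count_le (b : α) (ω : Ω) : count X n b ω ≤ n := by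
  classical
  unfold count
  refine (Finset.sum_le_card_nsmul _ _ 1 fun k _ => ?_).trans (by simp)
  split_ifs <;> simp

lemma exists_of_count_ne_zero {X : ℕ → Ω → α} {n : ℕ} {b : α} {ω : Ω} (h : count X n b ω ≠ 0) :
    ∃ k ∈ Finset.range n, X k ω = b := by
  classical
  unfold count at h
  obtain ⟨k, hk, hk'⟩ := Finset.exists_ne_zero_of_sum_ne_zero h
  exact ⟨k, hk, by by_contra hc; simp [hc] at hk'⟩

lemma finite_count_ne_zero (ω : Ω) : {i | count X n (a i) ω ≠ 0}.Finite := by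
  classical
  refine ((Finset.range n).image fun k => a.symm (X k ω)).finite_toSet.subset fun i hi => ?_
  obtain ⟨k, hk, hk'⟩ := exists_of_count_ne_zero hi
  exact Finset.mem_coe.2 (Finset.mem_image.2 ⟨k, hk, by simp [hk']⟩)

lemma phat_nonneg (b : α) (ω : Ω) : 0 ≤ phat X n b ω := by unfold phat; positivity

lemma phat_le_one (b : α) (ω : Ω) : phat X n b ω ≤ 1 :=
  div_le_one_of_le₀ (by exact_mod_cast count_le X n b ω) (by positivity)

lemma phat_eq_sum_indicator (b : α) (ω : Ω) :
    phat X n b ω = (n : ℝ)⁻¹ * ∑ k ∈ Finset.range n, ({ω | X k ω = b}.indicator 1 ω : ℝ) := by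
  classical
  rw [phat, count_cast, div_eq_inv_mul]
  congr 1

/-- Each observation contributes `f` at its own letter, so `f` need not be summable. -/
lemma hasSum_count_mul (f : ℕ+ → ℝ) (ω : Ω) :
    HasSum (fun i => (count X n (a i) ω : ℝ) * f i)
      (∑ k ∈ Finset.range n, f (a.symm (X k ω))) := by
  classical
  simp_rw [count_cast, Finset.sum_mul]
  refine hasSum_sum fun k _ => ?_
  have h := hasSum_ite_eq (a.symm (X k ω)) (f (a.symm (X k ω)))
  convert h using 2 with i
  by_cases hi : i = a.symm (X k ω)
  · simp [hi]
  · have : X k ω ≠ a i := fun h => hi (by simp [h])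
    simp [hi, this]

lemma hasSum_phat_mul (f : ℕ+ → ℝ) (ω : Ω) :
    HasSum (fun i => phat X n (a i) ω * f i)
      ((∑ k ∈ Finset.range n, f (a.symm (X k ω))) / n) := by
  refine ((hasSum_count_mul a X n f ω).div_const (n : ℝ)).congr_fun fun i => ?_
  rw [phat, div_mul_eq_mul_div]

lemma hasSum_phat (hn : 1 ≤ n) (ω : Ω) : HasSum (fun i => phat X n (a i) ω) 1 := by
  have h := hasSum_phat_mul a X n (fun _ => 1) ω
  have hn' : (n : ℝ) ≠ 0 := by positivity
  simpa [hn'] using h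

lemma hasSum_phat_mul_log_phat (ω : Ω) :
    HasSum (fun i => phat X n (a i) ω * Real.log (phat X n (a i) ω)) (-plugIn a X n ω) := by
  have : Summable fun i => phat X n (a i) ω * Real.log (phat X n (a i) ω) := by
    refine summable_of_hasFiniteSupport ((finite_count_ne_zero a X n ω).subset fun i hi hc => ?_)
    simp [phat, hc] at hi
  simpa [plugIn, entropy] using this.hasSum

/-- The plug-in estimator is a sample mean minus the divergence of the empirical distribution. -/
lemma hasSum_divTerm {p : ℕ+ → ℝ} (hp : HasSum p 1) (hn : 1 ≤ n) (ω : Ω) :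
    HasSum (fun i => divTerm (phat X n (a i) ω) (p i))
      (-plugIn a X n ω - (∑ k ∈ Finset.range n, logp a p X k ω) / n) := by
  -- The linear terms `-q + p` make each summand nonnegative yet cancel in total, since both laws
  -- have mass one.
  have h := (((hasSum_phat_mul_log_phat a X n ω).sub
    (hasSum_phat_mul a X n (fun i => Real.log (p i)) ω)).sub (hasSum_phat a X n hn ω)).add hp
  simpa [divTerm, logp] using h

/-- In `ℝ≥0∞` the expectation of `m̂` can be taken letter by letter. -/
lemma ofReal_mhat (ω : Ω) :
    ENNReal.ofReal (mhat a X n ω) = ∑' i, if 0 < count X n (a i) ω then (1 : ℝ≥0∞) else 0 := by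
  have hfin := finite_count_ne_zero a X n ω
  have h1 : mhat a X n ω = ∑ i ∈ hfin.toFinset, if 0 < count X n (a i) ω then 1 else 0 :=
    tsum_eq_sum fun i hi => by
      simp only [Set.Finite.mem_toFinset, Set.mem_ofPred_eq, not_not] at hi
      simp [hi]
  have h2 : ∑' i, (if 0 < count X n (a i) ω then (1 : ℝ≥0∞) else 0)
      = ∑ i ∈ hfin.toFinset, if 0 < count X n (a i) ω then (1 : ℝ≥0∞) else 0 :=
    tsum_eq_sum fun i hi => by
      simp only [Set.Finite.mem_toFinset, Set.mem_ofPred_eq, not_not] at hi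
      simp [hi]
  rw [h1, h2, ENNReal.ofReal_natCast]
  push_cast
  rfl

variable [MeasurableSpace Ω] {μ : Measure Ω} [IsProbabilityMeasure μ] {p : ℕ+ → ℝ} {a X}

lemma ae_count_eq_zero (hlaw : ∀ k i, μ.real {ω | X k ω = a i} = p i) :
    ∀ᵐ ω ∂μ, ∀ i, p i = 0 → count X n (a i) ω = 0 := by
  filter_upwards [ae_all_iff.2 fun k => ae_prob_pos (hlaw k)] with ω hω i hi
  by_contra hc
  obtain ⟨k, _, hk⟩ := exists_of_count_ne_zero hc
  have := hω k
  simp [hk, hi] at this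

/-- Only almost sure: as `Real.log 0 = 0`, `divTerm q 0` is negative for `0 < q ≤ 1`, but letters of
probability zero are almost surely unobserved. -/
lemma ae_divTerm_nonneg (hlaw : ∀ k i, μ.real {ω | X k ω = a i} = p i) :
    ∀ᵐ ω ∂μ, ∀ i, 0 ≤ divTerm (phat X n (a i) ω) (p i) := by
  filter_upwards [ae_count_eq_zero n hlaw] with ω hω i
  rcases (prob_nonneg (hlaw 0) i).eq_or_lt with h0 | h0
  · simp [divTerm, phat, hω i h0.symm, ← h0]
  · exact divTerm_nonneg (phat_nonneg _ _ _ _) h0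

variable [MeasurableSpace α] [MeasurableSingletonClass α]

lemma measurable_count (hX : ∀ k, Measurable (X k)) (b : α) : Measurable (count X n b) := by
  classical
  have : count X n b = fun ω => ∑ k ∈ Finset.range n, if X k ω = b then 1 else 0 := by
    funext ω; unfold count; congr
  rw [this]
  refine Finset.measurable_fun_sum _ fun k _ => ?_
  exact Measurable.ite (measurableSet_eq_letter (hX k) b) measurable_const measurable_const

lemma measurable_phat (hX : ∀ k, Measurable (X k)) (b : α) : Measurable (phat X n b) := by
  have : Measurable fun ω => (count X n b ω : ℝ) :=
    measurable_from_top.comp (measurable_count n hX b)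
  exact this.div_const _

lemma integrable_phat (hX : ∀ k, Measurable (X k)) (b : α) : Integrable (phat X n b) μ :=
  Integrable.of_bound (measurable_phat n hX b).aestronglyMeasurable 1
    (Filter.Eventually.of_forall fun ω => by
      rw [Real.norm_of_nonneg (phat_nonneg X n b ω)]; exact phat_le_one X n b ω)

lemma integral_phat (hX : ∀ k, Measurable (X k)) (hlaw : ∀ k i, μ.real {ω | X k ω = a i} = p i)
    (hn : 1 ≤ n) (i : ℕ+) : ∫ ω, phat X n (a i) ω ∂μ = p i := by
  have hn' : (n : ℝ) ≠ 0 := by positivity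
  simp_rw [phat_eq_sum_indicator]
  rw [integral_const_mul, integral_finsetSum]
  · simp_rw [integral_indicator_one (measurableSet_eq_letter (hX _) (a i)), hlaw]
    simp [hn']
  · intro k _
    exact (integrable_const (1 : ℝ)).indicator (measurableSet_eq_letter (hX k) (a i))

lemma integral_sq_phat_sub_le (hX : ∀ k, Measurable (X k)) (hindep : iIndepFun X μ)
    (hlaw : ∀ k i, μ.real {ω | X k ω = a i} = p i) (hn : 1 ≤ n) (i : ℕ+) :
    ∫ ω, (phat X n (a i) ω - p i) ^ 2 ∂μ ≤ p i / n := by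
  classical
  have hn' : (0 : ℝ) < n := by positivity
  have hms : ∀ k, MeasurableSet {ω | X k ω = a i} := fun k => measurableSet_eq_letter (hX k) (a i)
  set Z : ℕ → Ω → ℝ := fun k => {ω | X k ω = a i}.indicator 1 with hZ
  have hZL : ∀ k, MemLp (Z k) 2 μ := fun k =>
    MemLp.of_bound (C := 1) (measurable_one.indicator (hms k)).aestronglyMeasurable
      (Filter.Eventually.of_forall fun ω => by
        by_cases h : X k ω = a i <;> simp [hZ, h])
  have hZind : iIndepFun Z μ := by
    have h := hindep.comp (fun _ => ({a i} : Set α).indicator (1 : α → ℝ))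
      (fun _ => measurable_one.indicator (measurableSet_singleton _))
    have e : Z = fun k => ({a i} : Set α).indicator (1 : α → ℝ) ∘ X k := by
      funext k ω
      by_cases hk : X k ω = a i <;> simp [hZ, hk]
    rwa [e]
  have hvar : Var[∑ k ∈ Finset.range n, Z k; μ] ≤ n * p i := by
    rw [IndepFun.variance_sum (fun k _ => hZL k) fun j _ k _ hjk => hZind.indepFun hjk]
    have : ∀ k ∈ Finset.range n, Var[Z k; μ] ≤ p i := by
      intro k _
      refine (variance_le_expectation_sq (hZL k).aestronglyMeasurable).trans_eq ?_
      have hsq : (Z k) ^ 2 = Z k := by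
        funext ω
        by_cases h : X k ω = a i <;> simp [hZ, h]
      rw [hsq, hZ]
      exact (integral_indicator_one (hms k)).trans (hlaw k i)
    simpa using Finset.sum_le_card_nsmul _ _ _ this
  have hphat : phat X n (a i) = fun ω => (n : ℝ)⁻¹ * (∑ k ∈ Finset.range n, Z k) ω := by
    funext ω
    rw [phat_eq_sum_indicator, Finset.sum_apply]
  have hv : ∫ ω, (phat X n (a i) ω - p i) ^ 2 ∂μ = Var[phat X n (a i); μ] := by
    rw [variance_eq_integral (measurable_phat n hX _).aemeasurable, integral_phat n hX hlaw hn i]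
  rw [hv, hphat, variance_const_mul]
  calc _ ≤ (n : ℝ)⁻¹ ^ 2 * (n * p i) := by gcongr
    _ = _ := by field_simp

/-- The variance bound `p_i / n` cancels the chi-square denominator `p_i`. -/
lemma lintegral_divTerm_le_inv (hX : ∀ k, Measurable (X k)) (hindep : iIndepFun X μ)
    (hlaw : ∀ k i, μ.real {ω | X k ω = a i} = p i) (hn : 1 ≤ n) (i : ℕ+) :
    ∫⁻ ω, ENNReal.ofReal (divTerm (phat X n (a i) ω) (p i)) ∂μ ≤ ENNReal.ofReal (n : ℝ)⁻¹ := by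
  rcases (prob_nonneg (hlaw 0) i).eq_or_lt with h0 | h0
  · have : ∫⁻ ω, ENNReal.ofReal (divTerm (phat X n (a i) ω) (p i)) ∂μ = ∫⁻ _, 0 ∂μ := by
      refine lintegral_congr_ae ?_
      filter_upwards [ae_count_eq_zero n hlaw] with ω hω
      simp [divTerm, phat, hω i h0.symm, ← h0]
    simp [this]
  · have hint : Integrable (fun ω => (phat X n (a i) ω - p i) ^ 2 / p i) μ := by
      refine Integrable.div_const ?_ _
      refine Integrable.of_bound (((measurable_phat n hX _).sub_const _).pow_const 2).aestronglyMeasurable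
        1 (Filter.Eventually.of_forall fun ω => ?_)
      rw [Real.norm_of_nonneg (sq_nonneg _)]
      have h1 := phat_nonneg X n (a i) ω
      have h2 := phat_le_one X n (a i) ω
      have h3 := prob_le_one (hlaw 0) i
      nlinarith
    calc _ ≤ ∫⁻ ω, ENNReal.ofReal ((phat X n (a i) ω - p i) ^ 2 / p i) ∂μ :=
          lintegral_mono fun ω => ENNReal.ofReal_le_ofReal
            (divTerm_le_sq_div (phat_nonneg _ _ _ _) h0)
      _ = ENNReal.ofReal (∫ ω, (phat X n (a i) ω - p i) ^ 2 / p i ∂μ) :=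
          (ofReal_integral_eq_lintegral_ofReal hint
            (Filter.Eventually.of_forall fun ω => by positivity)).symm
      _ ≤ _ := by
          refine ENNReal.ofReal_le_ofReal ?_
          rw [integral_div, div_le_iff₀ h0]
          refine (integral_sq_phat_sub_le n hX hindep hlaw hn i).trans_eq ?_
          ring

lemma lintegral_divTerm_le_tail (hX : ∀ k, Measurable (X k))
    (hlaw : ∀ k i, μ.real {ω | X k ω = a i} = p i) (hn : 1 ≤ n) (i : ℕ+) :
    ∫⁻ ω, ENNReal.ofReal (divTerm (phat X n (a i) ω) (p i)) ∂μ
      ≤ ENNReal.ofReal (-(p i * Real.log (p i)) + p i) := by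
  have h0 := prob_nonneg (hlaw 0) i
  have hlog := Real.log_nonpos h0 (prob_le_one (hlaw 0) i)
  have hint : Integrable (fun ω => -(phat X n (a i) ω * Real.log (p i)) + p i) μ :=
    ((integrable_phat n hX (a i)).mul_const _).neg.add (integrable_const _)
  calc _ ≤ ∫⁻ ω, ENNReal.ofReal (-(phat X n (a i) ω * Real.log (p i)) + p i) ∂μ :=
        lintegral_mono fun ω => ENNReal.ofReal_le_ofReal
          (divTerm_le_of_le_one (phat_nonneg _ _ _ _) (phat_le_one _ _ _ _))
    _ = ENNReal.ofReal (∫ ω, (-(phat X n (a i) ω * Real.log (p i)) + p i) ∂μ) :=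
        (ofReal_integral_eq_lintegral_ofReal hint (Filter.Eventually.of_forall fun ω => by
          have := mul_nonpos_of_nonneg_of_nonpos (phat_nonneg X n (a i) ω) hlog
          simp only [Pi.zero_apply]
          linarith)).symm
    _ = _ := by
        have h1 : Integrable (fun ω => -(phat X n (a i) ω * Real.log (p i))) μ :=
          ((integrable_phat n hX (a i)).mul_const _).neg
        rw [integral_add h1 (integrable_const _), integral_neg,
          integral_mul_const, integral_phat n hX hlaw hn i]
        simp

/-- The indicator of `Y_i > 0` is at most `Y_i`. -/
lemma lintegral_observed_le (hX : ∀ k, Measurable (X k))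
    (hlaw : ∀ k i, μ.real {ω | X k ω = a i} = p i) (hn : 1 ≤ n) (i : ℕ+) :
    ∫⁻ ω, (if 0 < count X n (a i) ω then (1 : ℝ≥0∞) else 0) ∂μ ≤ ENNReal.ofReal (n * p i) := by
  have hn' : (0 : ℝ) < n := by positivity
  calc _ ≤ ∫⁻ ω, ENNReal.ofReal (n * phat X n (a i) ω) ∂μ := by
        refine lintegral_mono fun ω => ?_
        split_ifs with h
        · rw [ENNReal.one_le_ofReal, phat, mul_div_cancel₀ _ hn'.ne']
          exact_mod_cast h
        · simp
    _ = ENNReal.ofReal (∫ ω, n * phat X n (a i) ω ∂μ) :=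
        (ofReal_integral_eq_lintegral_ofReal ((integrable_phat n hX (a i)).const_mul _)
          (Filter.Eventually.of_forall fun ω =>
            mul_nonneg hn'.le (phat_nonneg X n (a i) ω))).symm
    _ = _ := by rw [integral_const_mul, integral_phat n hX hlaw hn i]

end Count

/-! ### Splitting series at an index -/

section TailSum

lemma summable_tail {f : ℕ+ → ℝ} (hf : Summable f) (k : ℤ) :
    Summable fun i : ℕ+ => if k ≤ ((i : ℕ) : ℤ) then f i else 0 :=
  (hf.indicator {i : ℕ+ | k ≤ ((i : ℕ) : ℤ)}).congr fun i => by
    simp [Set.indicator_apply]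

lemma tailSum_nonneg {f : ℕ+ → ℝ} (hf : ∀ i, 0 ≤ f i) (k : ℤ) : 0 ≤ tailSum f k :=
  tsum_nonneg fun i => by split_ifs <;> simp [hf]

lemma tailSum_neg_add {f g : ℕ+ → ℝ} (hf : Summable f) (hg : Summable g) (k : ℤ) :
    tailSum (fun i => -f i + g i) k = -tailSum f k + tailSum g k := by
  unfold tailSum
  rw [← tsum_neg, ← (summable_tail hf k).neg.tsum_add (summable_tail hg k)]
  congr 1
  funext i
  split_ifs <;> simp

lemma tailSum_const_mul (f : ℕ+ → ℝ) (c : ℝ) (k : ℤ) :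
    tailSum (fun i => c * f i) k = c * tailSum f k := by
  unfold tailSum
  rw [← tsum_mul_left]
  congr 1
  funext i
  split_ifs <;> simp

/-- Splitting of a series into a constant bound below the index `k` and a tail from `k` on. -/
lemma tsum_le_head_add_tailSum {F : ℕ+ → ℝ≥0∞} {f : ℕ+ → ℝ} {c : ℝ≥0∞} (hf : Summable f)
    (hf0 : ∀ i, 0 ≤ f i) (hc : ∀ i, F i ≤ c) (hF : ∀ i, F i ≤ ENNReal.ofReal (f i)) (k : ℤ) :
    ∑' i, F i ≤ k.toNat * c + ENNReal.ofReal (tailSum f k) := by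
  have h1 : ∀ i : ℕ+, F i ≤ (if ((i : ℕ) : ℤ) < k then c else 0)
      + ENNReal.ofReal (if k ≤ ((i : ℕ) : ℤ) then f i else 0) := by
    intro i
    rcases lt_or_ge ((i : ℕ) : ℤ) k with h | h
    · simpa [h, not_le.2 h] using hc i
    · simpa [h, not_lt.2 h] using hF i
  refine (ENNReal.tsum_le_tsum h1).trans ?_
  rw [ENNReal.tsum_add, tailSum, ENNReal.ofReal_tsum_of_nonneg
    (fun i => by split_ifs <;> simp [hf0]) (summable_tail hf k)]
  gcongr
  -- Passing to `ℕ` admits the extra index `0`, a harmless overcount; `toNat` covers negative `k`.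
  calc _ ≤ ∑' i : ℕ, (if (i : ℤ) < k then c else 0) :=
        ENNReal.tsum_comp_le_tsum_of_injective PNat.coe_injective
          (fun i : ℕ => if (i : ℤ) < k then c else 0)
    _ = ∑ i ∈ Finset.range k.toNat, (if (i : ℤ) < k then c else 0) :=
        tsum_eq_sum fun i hi => by
          simp only [Finset.mem_range, not_lt] at hi
          rw [if_neg]; omega
    _ ≤ _ := by
        refine (Finset.sum_le_card_nsmul _ _ c fun i _ => ?_).trans_eq (by simp)
        split_ifs <;> simp

end TailSum

/-! ### Decomposition, remainder estimate and conclusion -/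

section Main

variable {Ω α : Type*} {a : ℕ+ ≃ α} {p : ℕ+ → ℝ} {X : ℕ → Ω → α}

/-- Separates the i.i.d. sum from the remainder; the subtracted bracket is the divergence of
`hasSum_divTerm`. -/
lemma estimator_sub_entropy_eq (σ : ℝ) {n : ℕ} (hn : 1 ≤ n) (ω : Ω) :
    √n * (estimator a X n ω - entropy p) / σ
      = (√n)⁻¹ * ∑ k ∈ Finset.range n, (-logp a p X k ω - entropy p) / σ
        + √n / σ * (((mhat a X n ω : ℝ) - 1) / (2 * n)
          - (-plugIn a X n ω - (∑ k ∈ Finset.range n, logp a p X k ω) / n)) := by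
  have hn0 : (0 : ℝ) < n := by positivity
  have hs : (√(n : ℝ))⁻¹ = √n / n := by
    rw [eq_div_iff hn0.ne', inv_mul_eq_iff_eq_mul₀ (Real.sqrt_ne_zero'.2 hn0),
      Real.mul_self_sqrt hn0.le]
  rw [← Finset.sum_div, Finset.sum_sub_distrib, Finset.sum_neg_distrib, hs, estimator]
  simp only [Finset.sum_const, Finset.card_range, nsmul_eq_mul]
  field_simp
  ring

variable [MeasurableSpace Ω] {μ : Measure Ω}

/-- Letters of positive probability are not null events, so zero variance would make `ln p` equal on
all of them, and `log` is injective there. -/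
lemma variance_logp_ne_zero [IsProbabilityMeasure μ] (hlaw : ∀ k i, μ.real {ω | X k ω = a i} = p i)
    (hL : MemLp (logp a p X 0) 2 μ) (hnonunif : Nonuniform p) : Var[logp a p X 0; μ] ≠ 0 := by
  intro h0
  have hae := ae_eq_integral_of_variance_eq_zero hL h0
  have key : ∀ i, 0 < p i → Real.log (p i) = ∫ ω, logp a p X 0 ω ∂μ := by
    intro i hi
    have hne : μ {ω | X 0 ω = a i} ≠ 0 := by
      intro h
      rw [← hlaw 0 i, measureReal_def, h] at hi
      simp at hi
    have hfreq : ∃ᵐ ω ∂μ, X 0 ω = a i := frequently_ae_iff.2 hne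
    obtain ⟨ω, h1, h2⟩ := (hfreq.and_eventually hae).exists
    rw [← h2, logp, h1, a.symm_apply_apply]
  obtain ⟨i, j, hi, hj, hij⟩ := hnonunif
  exact hij (Real.log_injOn_pos hi hj ((key i hi).trans (key j hj).symm))

variable [MeasurableSpace α] [MeasurableSingletonClass α]

lemma measurable_logp (hX : ∀ k, Measurable (X k)) (k : ℕ) : Measurable (logp a p X k) :=
  measurable_comp_letter a (hX k) fun b => Real.log (p (a.symm b))

lemma memLp_logp (hX : ∀ k, Measurable (X k)) {r : ℝ} (hr : 0 < r)
    (hmoment : Integrable (fun ω => |logp a p X 0 ω| ^ r) μ) :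
    MemLp (logp a p X 0) (ENNReal.ofReal r) μ := by
  rw [← integrable_norm_rpow_iff (measurable_logp hX 0).aestronglyMeasurable (by simpa using hr)
    ENNReal.ofReal_ne_top, ENNReal.toReal_ofReal hr.le]
  exact hmoment

lemma hasSum_prob_mul_log (hX : ∀ k, Measurable (X k))
    (hlaw : ∀ k i, μ.real {ω | X k ω = a i} = p i) (hint : Integrable (logp a p X 0) μ) :
    HasSum (fun i => p i * Real.log (p i)) (∫ ω, logp a p X 0 ω ∂μ) :=
  hasSum_prob_mul (hX 0) (hlaw 0) (f := fun i => Real.log (p i)) hint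

lemma entropy_eq_neg_integral (hX : ∀ k, Measurable (X k))
    (hlaw : ∀ k i, μ.real {ω | X k ω = a i} = p i) (hint : Integrable (logp a p X 0) μ) :
    entropy p = -∫ ω, logp a p X 0 ω ∂μ := by
  rw [entropy, (hasSum_prob_mul_log hX hlaw hint).tsum_eq]

variable [IsProbabilityMeasure μ]

/-- The standardized sample mean of the information content obeys a Berry–Esseen bound. -/
lemma exists_abs_real_sum_logp_sub_Phi_le (hX : ∀ k, Measurable (X k)) (hindep : iIndepFun X μ)
    (hlaw : ∀ k i, μ.real {ω | X k ω = a i} = p i) (hnonunif : Nonuniform p)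
    {δ : ℝ} (hδ : 0 < δ) (hδ' : δ ≤ 1 / 2)
    (hmoment : Integrable (fun ω => |logp a p X 0 ω| ^ (2 + δ)) μ) :
    ∃ C : ℝ, 0 ≤ C ∧ ∀ n : ℕ, 1 ≤ n → ∀ x : ℝ,
      |μ.real {ω | (√n)⁻¹ * ∑ k ∈ Finset.range n,
        (-logp a p X k ω - entropy p) / √(Var[logp a p X 0; μ]) < x} - Phi x|
        ≤ C * (n : ℝ) ^ (-δ / 2) := by
  have hLδ := memLp_logp hX (by linarith) hmoment
  have hL2 : MemLp (logp a p X 0) 2 μ := hLδ.mono_exponent (by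
    rw [← ENNReal.ofReal_ofNat]; exact ENNReal.ofReal_le_ofReal (by linarith))
  have hL1 : Integrable (logp a p X 0) μ := hL2.integrable (by norm_num)
  have hV := variance_logp_ne_zero hlaw hL2 hnonunif
  have hVpos : 0 < Var[logp a p X 0; μ] := lt_of_le_of_ne (variance_nonneg _ _) hV.symm
  have hH := entropy_eq_neg_integral hX hlaw hL1
  set σ := √(Var[logp a p X 0; μ]) with hσ
  have hσ0 : 0 < σ := Real.sqrt_pos.2 hVpos
  set h : α → ℝ := fun b => (-Real.log (p (a.symm b)) - entropy p) / σ
  have hα : Countable α := a.symm.injective.countable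
  have hhm : Measurable h := measurable_of_countable h
  set Y : ℕ → Ω → ℝ := fun k ω => (-logp a p X k ω - entropy p) / σ with hY
  have hYind : iIndepFun Y μ := hindep.comp (fun _ => h) fun _ => hhm
  have hYid : ∀ i, IdentDistrib (Y i) (Y 0) μ μ := fun i =>
    (identDistrib_letter (hX i) (hX 0) (hlaw i) (hlaw 0)).comp hhm
  have hYL : MemLp (Y 0) (ENNReal.ofReal (2 + δ)) μ := by
    have := (hLδ.neg.sub (memLp_const (entropy p))).mul_const (σ⁻¹)
    simpa [hY, div_eq_mul_inv, Pi.sub_def, Pi.neg_def] using this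
  have hYL2 : MemLp (Y 0) 2 μ := hYL.mono_exponent (by
    rw [← ENNReal.ofReal_ofNat]; exact ENNReal.ofReal_le_ofReal (by linarith))
  refine exists_abs_real_sum_lt_sub_Phi_le hδ hδ' hYind hYid ?_ ?_ hYL2 ?_
  · change ∫ ω, (-logp a p X 0 ω - entropy p) / σ ∂μ = 0
    have hneg : Integrable (fun ω => -logp a p X 0 ω) μ := hL1.neg
    rw [integral_div, integral_sub hneg (integrable_const _), integral_neg, integral_const, hH]
    simp
  · have : ∀ ω, (Y 0 ^ 2) ω = (logp a p X 0 ω - ∫ ω, logp a p X 0 ω ∂μ) ^ 2 / σ ^ 2 := by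
      intro ω
      change ((-logp a p X 0 ω - entropy p) / σ) ^ 2 = _
      rw [hH]
      ring
    rw [integral_congr_ae (.of_forall this), integral_div,
      ← variance_eq_integral (measurable_logp hX 0).aemeasurable, hσ,
      Real.sq_sqrt hVpos.le, div_self hV]
  · have h1 := (integrable_norm_rpow_iff hYL.aestronglyMeasurable
      (by simp; linarith) ENNReal.ofReal_ne_top).2 hYL
    rw [ENNReal.toReal_ofReal (by linarith)] at h1
    exact h1

/-- The divergence of the empirical law from the true law, together with the Miller–Madow
correction, is of order `n ^ (-1/2 - δ)` in expectation. -/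
lemma lintegral_remainder_le (hX : ∀ k, Measurable (X k)) (hindep : iIndepFun X μ)
    (hlaw : ∀ k i, μ.real {ω | X k ω = a i} = p i) (hsum : Summable fun i => p i * Real.log (p i))
    {δ : ℝ} (hδ' : δ ≤ 1 / 2) {k : ℤ} {C : ℝ} {n : ℕ} (hn : 3 ≤ n)
    (hK : (k : ℝ) ≤ (n : ℝ) ^ (1 / 2 - δ))
    (htail : (n : ℝ) ^ (1 / 2 + δ) * Real.log n * tailSum p k ≤ C)
    (hent : -(n : ℝ) ^ (1 / 2 + δ) * tailSum (fun i => p i * Real.log (p i)) k ≤ C) :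
    0 ≤ C ∧
    ∫⁻ ω, (∑' i, ENNReal.ofReal (divTerm (phat X n (a i) ω) (p i))
      + (ENNReal.ofReal (n : ℝ)⁻¹ * ∑' i, (if 0 < count X n (a i) ω then (1 : ℝ≥0∞) else 0)
        + ENNReal.ofReal (n : ℝ)⁻¹)) ∂μ
      ≤ ENNReal.ofReal ((3 + 3 * C) * (n : ℝ) ^ (-(1 / 2 + δ))) := by
  have hn1 : 1 ≤ n := by omega
  have hn0 : (0 : ℝ) < n := by positivity
  have hp0 := prob_nonneg (hlaw 0)
  have hp := (hasSum_prob (hX 0) (hlaw 0)).summable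
  -- The reason for `n ≥ 3`: the logarithm in the tail hypothesis can then be dropped.
  have hlog : 1 ≤ Real.log n := by
    rw [Real.le_log_iff_exp_le hn0]
    have h3 : (3 : ℝ) ≤ n := by exact_mod_cast hn
    linarith [Real.exp_one_lt_d9]
  set w : ℝ := (n : ℝ) ^ (-(1 / 2 + δ)) with hw
  have hw0 : 0 < w := by positivity
  have hwinv : (n : ℝ) ^ (1 / 2 + δ) = w⁻¹ := by rw [hw, Real.rpow_neg hn0.le, inv_inv]
  have hT0 : 0 ≤ tailSum p k := tailSum_nonneg hp0 k
  have hC0 : 0 ≤ C :=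
    (mul_nonneg (mul_nonneg (by positivity) (by linarith)) hT0).trans htail
  have hT : tailSum p k ≤ C * w := by
    rw [hwinv] at htail
    have h1 : w⁻¹ * 1 * tailSum p k ≤ w⁻¹ * Real.log n * tailSum p k := by gcongr
    have h2 := h1.trans htail
    rw [mul_one, inv_mul_le_iff₀ hw0] at h2
    linarith
  have hE : -tailSum (fun i => p i * Real.log (p i)) k ≤ C * w := by
    rw [hwinv, neg_mul, ← mul_neg, inv_mul_le_iff₀ hw0] at hent
    linarith
  -- The head has at most `n w` letters, so a cost of `1/n` each totals at most `w`.
  have hkw : (k.toNat : ℝ) ≤ n * w := by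
    have e : (n : ℝ) * w = (n : ℝ) ^ (1 / 2 - δ) := by
      rw [hw]
      nth_rw 1 [← Real.rpow_one (n : ℝ)]
      rw [← Real.rpow_add hn0]
      congr 1; ring
    rw [e]
    rcases le_total k 0 with h | h
    · rw [Int.toNat_of_nonpos h, Nat.cast_zero]; positivity
    · have : ((k.toNat : ℤ) : ℝ) = (k : ℝ) := by rw [Int.toNat_of_nonneg h]
      rw [← Int.cast_natCast, this]
      exact hK
  have hninv : (n : ℝ)⁻¹ ≤ w := by
    rw [hw, ← Real.rpow_neg_one]
    exact Real.rpow_le_rpow_of_exponent_le (by exact_mod_cast hn1) (by linarith)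
  have hm1 : ∀ i, Measurable fun ω => ENNReal.ofReal (divTerm (phat X n (a i) ω) (p i)) := by
    intro i
    have hm := measurable_phat n hX (a i)
    exact (((hm.mul (Real.measurable_log.comp hm)).sub (hm.mul_const _)).sub hm
      |>.add_const _).ennreal_ofReal
  have hm2 : ∀ i, Measurable fun ω => if 0 < count X n (a i) ω then (1 : ℝ≥0∞) else 0 := fun i =>
    Measurable.ite (measurable_count n hX (a i) measurableSet_Ioi) measurable_const
      measurable_const
  refine ⟨hC0, ?_⟩
  have h1 : ∫⁻ ω, ∑' i, ENNReal.ofReal (divTerm (phat X n (a i) ω) (p i)) ∂μ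
      ≤ ENNReal.ofReal ((1 + 2 * C) * w) := by
    rw [lintegral_tsum fun i => (hm1 i).aemeasurable]
    refine (tsum_le_head_add_tailSum (f := fun i => -(p i * Real.log (p i)) + p i)
      (hsum.neg.add hp) (fun i => ?_) (lintegral_divTerm_le_inv n hX hindep hlaw hn1)
      (lintegral_divTerm_le_tail n hX hlaw hn1) k).trans ?_
    · have := mul_nonpos_of_nonneg_of_nonpos (hp0 i)
        (Real.log_nonpos (hp0 i) (prob_le_one (hlaw 0) i))
      linarith [hp0 i]
    · rw [tailSum_neg_add hsum hp, ← ENNReal.ofReal_natCast, ← ENNReal.ofReal_mul (by positivity)]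
      have h2 : (k.toNat : ℝ) * (n : ℝ)⁻¹ ≤ w := by
        rw [mul_inv_le_iff₀ hn0]; linarith
      rw [show (1 + 2 * C) * w = w + (C * w + C * w) by ring,
        ENNReal.ofReal_add hw0.le (by positivity)]
      gcongr
  have h2 : ∫⁻ ω, ∑' i, (if 0 < count X n (a i) ω then (1 : ℝ≥0∞) else 0) ∂μ
      ≤ ENNReal.ofReal ((1 + C) * (n * w)) := by
    rw [lintegral_tsum fun i => (hm2 i).aemeasurable]
    refine (tsum_le_head_add_tailSum (f := fun i => n * p i) (c := 1)
      (hp.mul_left _) (fun i => mul_nonneg hn0.le (hp0 i)) (fun i => ?_)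
      (lintegral_observed_le n hX hlaw hn1) k).trans ?_
    · calc _ ≤ ∫⁻ _, 1 ∂μ := lintegral_mono fun ω => by split_ifs <;> simp
        _ = 1 := by simp
    · rw [tailSum_const_mul, mul_one, ← ENNReal.ofReal_natCast,
        show (1 + C) * (n * w) = n * w + n * (C * w) by ring,
        ENNReal.ofReal_add (by positivity) (by positivity)]
      gcongr
  rw [lintegral_add_left (Measurable.tsum hm1), lintegral_add_right _ measurable_const,
    lintegral_const_mul _ (Measurable.tsum hm2), lintegral_const, measure_univ, mul_one]
  -- The constant is `(1 + 2C) + (1 + C) + 1`: divergence, observed letters, and the isolated `1/n ≤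
  -- w`.
  calc _ ≤ ENNReal.ofReal ((1 + 2 * C) * w)
        + (ENNReal.ofReal (n : ℝ)⁻¹ * ENNReal.ofReal ((1 + C) * (n * w)) + ENNReal.ofReal w) := by
        gcongr
    _ = ENNReal.ofReal ((1 + 2 * C) * w + ((n : ℝ)⁻¹ * ((1 + C) * (n * w)) + w)) := by
        rw [← ENNReal.ofReal_mul (by positivity), ← ENNReal.ofReal_add (by positivity) hw0.le,
          ← ENNReal.ofReal_add (by positivity) (by positivity)]
    _ = _ := by
        congr 1
        field_simp
        ring

/-- The normalized remainder is at most `n ^ (-δ / 2)` outside an event of probability of order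
`n ^ (-δ / 2)`. -/
lemma real_remainder_gt_le (hX : ∀ k, Measurable (X k)) (hindep : iIndepFun X μ)
    (hlaw : ∀ k i, μ.real {ω | X k ω = a i} = p i) (hsum : Summable fun i => p i * Real.log (p i))
    {σ : ℝ} (hσ : 0 < σ) {δ : ℝ} (hδ' : δ ≤ 1 / 2) {k : ℤ} {C : ℝ} {n : ℕ} (hn : 3 ≤ n)
    (hK : (k : ℝ) ≤ (n : ℝ) ^ (1 / 2 - δ))
    (htail : (n : ℝ) ^ (1 / 2 + δ) * Real.log n * tailSum p k ≤ C)
    (hent : -(n : ℝ) ^ (1 / 2 + δ) * tailSum (fun i => p i * Real.log (p i)) k ≤ C) :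
    μ.real {ω | (n : ℝ) ^ (-δ / 2) < |√n / σ * (((mhat a X n ω : ℝ) - 1) / (2 * n)
          - (-plugIn a X n ω - (∑ k ∈ Finset.range n, logp a p X k ω) / n))|}
      ≤ (3 + 3 * C) / σ * (n : ℝ) ^ (-δ / 2) := by
  have hn1 : 1 ≤ n := by omega
  have hn0 : (0 : ℝ) < n := by positivity
  obtain ⟨hC0, hU⟩ := lintegral_remainder_le hX hindep hlaw hsum hδ' hn hK htail hent
  set U : Ω → ℝ≥0∞ := fun ω => ∑' i, ENNReal.ofReal (divTerm (phat X n (a i) ω) (p i))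
      + (ENNReal.ofReal (n : ℝ)⁻¹ * ∑' i, (if 0 < count X n (a i) ω then (1 : ℝ≥0∞) else 0)
        + ENNReal.ofReal (n : ℝ)⁻¹) with hUdef
  set ε : ℝ := (n : ℝ) ^ (-δ / 2) with hε
  have hε0 : 0 < ε := by positivity
  have hsn : 0 < √(n : ℝ) := Real.sqrt_pos.2 hn0
  have hpsum := hasSum_prob (hX 0) (hlaw 0)
  have hUm : Measurable U := by
    have hm1 : ∀ i, Measurable fun ω => ENNReal.ofReal (divTerm (phat X n (a i) ω) (p i)) := by
      intro i
      have hm := measurable_phat n hX (a i)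
      exact (((hm.mul (Real.measurable_log.comp hm)).sub (hm.mul_const _)).sub hm
        |>.add_const _).ennreal_ofReal
    have hm2 : ∀ i, Measurable fun ω => if 0 < count X n (a i) ω then (1 : ℝ≥0∞) else 0 := fun i =>
      Measurable.ite (measurable_count n hX (a i) measurableSet_Ioi) measurable_const
        measurable_const
    exact (Measurable.tsum hm1).add (((Measurable.tsum hm2).const_mul _).add_const _)
  have hRU : ∀ᵐ ω ∂μ, ENNReal.ofReal |((mhat a X n ω : ℝ) - 1) / (2 * n)
      - (-plugIn a X n ω - (∑ k ∈ Finset.range n, logp a p X k ω) / n)| ≤ U ω := by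
    filter_upwards [ae_divTerm_nonneg n hlaw] with ω hω
    have hs := hasSum_divTerm a X n hpsum hn1 ω
    have hnn := hs.nonneg hω
    have e1 : ∑' i, ENNReal.ofReal (divTerm (phat X n (a i) ω) (p i))
        = ENNReal.ofReal (-plugIn a X n ω - (∑ k ∈ Finset.range n, logp a p X k ω) / n) := by
      rw [← ENNReal.ofReal_tsum_of_nonneg hω hs.summable, hs.tsum_eq]
    simp only [hUdef]
    rw [e1, ← ofReal_mhat, ← ENNReal.ofReal_mul (by positivity),
      ← ENNReal.ofReal_add (by positivity) (by positivity),
      ← ENNReal.ofReal_add hnn (by positivity)]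
    refine ENNReal.ofReal_le_ofReal ?_
    have hm0 : (0 : ℝ) ≤ mhat a X n ω := Nat.cast_nonneg _
    have h1 : |((mhat a X n ω : ℝ) - 1) / (2 * n)|
        ≤ (n : ℝ)⁻¹ * (mhat a X n ω : ℝ) + (n : ℝ)⁻¹ := by
      rw [abs_div, abs_of_pos (by positivity : (0 : ℝ) < 2 * n), div_le_iff₀ (by positivity)]
      have : ((n : ℝ)⁻¹ * (mhat a X n ω : ℝ) + (n : ℝ)⁻¹) * (2 * n)
          = 2 * (mhat a X n ω : ℝ) + 2 := by field_simp
      rw [this, abs_le]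
      constructor <;> linarith
    refine (abs_sub _ _).trans ?_
    rw [abs_of_nonneg hnn]
    linarith
  -- The threshold `ε` with the normalization `√n / σ` removed.
  set η : ℝ := ε * σ / √n with hη
  have hη0 : 0 < η := by positivity
  have hmeas : μ {ω | ε < |√n / σ * (((mhat a X n ω : ℝ) - 1) / (2 * n)
          - (-plugIn a X n ω - (∑ k ∈ Finset.range n, logp a p X k ω) / n))|}
      ≤ μ {ω | ENNReal.ofReal η ≤ U ω} := by
    refine measure_mono_ae ?_
    filter_upwards [hRU] with ω hω h
    refine le_trans (ENNReal.ofReal_le_ofReal ?_) hω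
    have h' : ε < |√n / σ * (((mhat a X n ω : ℝ) - 1) / (2 * n)
          - (-plugIn a X n ω - (∑ k ∈ Finset.range n, logp a p X k ω) / n))| := h
    rw [abs_mul, abs_of_pos (by positivity : 0 < √(n : ℝ) / σ)] at h'
    rw [hη, div_le_iff₀ hsn]
    rw [div_mul_eq_mul_div, lt_div_iff₀ hσ] at h'
    linarith
  have hmarkov := meas_ge_le_lintegral_div (μ := μ) hUm.aemeasurable (ε := ENNReal.ofReal η)
    (by simpa using hη0) ENNReal.ofReal_ne_top
  have hfin : μ {ω | ε < |√n / σ * (((mhat a X n ω : ℝ) - 1) / (2 * n)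
          - (-plugIn a X n ω - (∑ k ∈ Finset.range n, logp a p X k ω) / n))|}
      ≤ ENNReal.ofReal ((3 + 3 * C) * (n : ℝ) ^ (-(1 / 2 + δ)) / η) := by
    rw [ENNReal.ofReal_div_of_pos hη0]
    exact hmeas.trans (hmarkov.trans (ENNReal.div_le_div_right hU _))
  refine (ENNReal.toReal_le_of_le_ofReal (by positivity) hfin).trans_eq ?_
  -- Since the mean is of order `ε² / √n`, Markov's quotient by `η` is of order `ε`: threshold and
  -- probability balance.
  have e : (n : ℝ) ^ (-(1 / 2 + δ)) = ε * ε / √n := by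
    rw [eq_div_iff hsn.ne', Real.sqrt_eq_rpow, hε, ← Real.rpow_add hn0, ← Real.rpow_add hn0]
    congr 1; ring
  rw [e, hη]
  field_simp

end Main

end MillerMadow

theorem theorem3p2 {Ω α : Type*} [MeasurableSpace Ω] (μ : Measure Ω) [IsProbabilityMeasure μ]
    [MeasurableSpace α] [MeasurableSingletonClass α] (a : ℕ+ ≃ α)
    (p : ℕ+ → ℝ) (X : ℕ → Ω → α)
    (hmeas : ∀ k, Measurable (X k)) (hindep : iIndepFun X μ)
    (hlaw : ∀ k i, μ.real {ω | X k ω = a i} = p i)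
    (hnonunif : MillerMadow.Nonuniform p)
    (δ : ℝ) (hδ : 0 < δ) (hδ' : δ < 1 / 2)
    (hmoment : Integrable (fun ω => |MillerMadow.logp a p X 0 ω| ^ (2 + δ)) μ)
    (K : ℕ → ℤ) (C : ℝ)
    (hK : ∀ n : ℕ, 1 ≤ n → (K n : ℝ) ≤ (n : ℝ) ^ (1 / 2 - δ))
    (htail : ∀ n : ℕ, 1 ≤ n →
      (n : ℝ) ^ (1 / 2 + δ) * Real.log n * MillerMadow.tailSum p (K n) ≤ C)
    (hent : ∀ n : ℕ, 1 ≤ n →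
      -(n : ℝ) ^ (1 / 2 + δ) * MillerMadow.tailSum (fun i => p i * Real.log (p i)) (K n) ≤ C) :
    ∃ C' : ℝ, ∀ n : ℕ, 1 ≤ n → ∀ x : ℝ,
      |μ.real {ω | √n * (MillerMadow.estimator a X n ω - MillerMadow.entropy p)
            / √(Var[MillerMadow.logp a p X 0; μ]) < x} - MillerMadow.Phi x|
        ≤ C' * (n : ℝ) ^ (-δ / 2) := by
  have hLδ := MillerMadow.memLp_logp hmeas (by linarith) hmoment
  have hL2 : MemLp (MillerMadow.logp a p X 0) 2 μ := hLδ.mono_exponent (by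
    rw [← ENNReal.ofReal_ofNat]; exact ENNReal.ofReal_le_ofReal (by linarith))
  have hsum := (MillerMadow.hasSum_prob_mul_log hmeas hlaw (hL2.integrable (by norm_num))).summable
  have hσ : 0 < √(Var[MillerMadow.logp a p X 0; μ]) :=
    Real.sqrt_pos.2 (lt_of_le_of_ne (variance_nonneg _ _)
      (MillerMadow.variance_logp_ne_zero hlaw hL2 hnonunif).symm)
  obtain ⟨B, hB0, hB⟩ := MillerMadow.exists_abs_real_sum_logp_sub_Phi_le hmeas hindep hlaw hnonunif
    hδ hδ'.le hmoment
  set σ := √(Var[MillerMadow.logp a p X 0; μ])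
  have hC0 : 0 ≤ C := by
    refine le_trans (mul_nonneg (mul_nonneg (by positivity) (Real.log_natCast_nonneg 1))
      (MillerMadow.tailSum_nonneg (MillerMadow.prob_nonneg (hlaw 0)) _)) (htail 1 le_rfl)
  -- `2` handles `n < 3`, where `n^(-δ/2) ≥ 1/2`. `B` is the Berry–Esseen constant, `1` the
  -- threshold and the last term the exceptional probability.
  refine ⟨2 + (B + 1 + (3 + 3 * C) / σ), fun n hn x => ?_⟩
  have hn0 : (0 : ℝ) < n := by positivity
  rcases lt_or_ge n 3 with h3 | h3
  · have h1 : |μ.real {ω | √n * (MillerMadow.estimator a X n ω - MillerMadow.entropy p) / σ < x}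
        - MillerMadow.Phi x| ≤ 1 := by
      have h2 : μ.real {ω | √n * (MillerMadow.estimator a X n ω - MillerMadow.entropy p) / σ < x}
        ≤ 1 := measureReal_le_one
      have h4 : 0 ≤ μ.real
        {ω | √n * (MillerMadow.estimator a X n ω - MillerMadow.entropy p) / σ < x} :=
        measureReal_nonneg
      have h5 := MillerMadow.Phi_nonneg x
      have h6 := MillerMadow.Phi_le_one x
      rw [abs_le]
      constructor <;> linarith
    have h2 : 1 / 2 ≤ (n : ℝ) ^ (-δ / 2) := by
      have hn2 : (n : ℝ) ≤ 2 := by exact_mod_cast (by omega : n ≤ 2)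
      have hn1 : (1 : ℝ) ≤ n := by exact_mod_cast hn
      calc (1 / 2 : ℝ) ≤ (n : ℝ)⁻¹ := by
            rw [one_div]; exact inv_anti₀ hn0 hn2
        _ = (n : ℝ) ^ (-1 : ℝ) := (Real.rpow_neg_one _).symm
        _ ≤ _ := Real.rpow_le_rpow_of_exponent_le hn1 (by linarith)
    have h4 : 0 ≤ B + 1 + (3 + 3 * C) / σ := by positivity
    nlinarith
  · have hS := MillerMadow.abs_real_add_lt_sub_Phi_le (by positivity) (hB n hn)
      (MillerMadow.real_remainder_gt_le hmeas hindep hlaw hsum hσ hδ'.le h3 (hK n hn) (htail n hn)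
        (hent n hn)) x
    simp_rw [MillerMadow.estimator_sub_entropy_eq (p := p) σ hn]
    refine hS.trans ?_
    have : 0 ≤ (n : ℝ) ^ (-δ / 2) := by positivity
    linarith
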